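/- \textbf{Setting.} Let $G=(V,E)$ be a finite graph with $|V|=n$, let $\mathcal J=\{J_e\in\mathbb R: e\in E\}$ and $\beta>0$, and let $\mu=\mu_{G,\mathcal J,\beta}$ be the distribution on $\{\pm1\}^V$ with $\mu(\sigma)\propto\exp\big(\beta\sum_{x\sim y}\mathbf 1\{\sigma(x)=\sigma(y)\}J_{\{x,y\}}\big)$. Put $\Gamma_e=\frac{|1-e^{\beta J_e}|}{1+e^{\beta J_e}}$ and $A(u)=\sum_{w\sim u}\Gamma_{\{u,w\}}$. For $\varepsilon,d>0$ let $M(u)=1-\frac{\varepsilon}{4}$ if $A(u)\le 1-\frac{\varepsilon}{2}$ and $M(u)=d\cdot A(u)$ otherwise; for a path $P$ let $M(P)$ be the product of $M(u)$ over the vertices $u$ of $P$. A vertex $u$ is a $(d,\varepsilon)$-\emph{block vertex} if $M(P)<1$ for every path $P$ of length at most $\log n$ starting at $u$. For $B\subseteq V$, $\partial_{\rm out}B$ is the set of vertices outside $B$ with a neighbour in $B$. \textbf{Block partitions.} A partition $\mathcal B$ of $V$ is a $(d,\varepsilon)$-\emph{block partition} if every $B\in\mathcal B$ satisfies: (1)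 $B$ induces a tree with at most one extra edge; (2) if $|B|\ge2$, then every $w\in\partial_{\rm out}B$ is a $(d,\varepsilon)$-block vertex and has exactly one neighbour in $B$, and a cycle in $B$, if there is one, has length at most $4\frac{\log n}{\log^4 d}$ and is at distance at least $\log^5 d$ from $\partial_{\rm out}B$; (3) if $|B|=1$, its vertex is a $(d,\varepsilon)$-block vertex. It is \emph{shallow} if in every block $B$ with $|B|\ge2$, with distances measured inside the subgraph induced by $B$: if $B$ is a tree, then some $r\in B$ has all vertices of $B$ within distance $4\frac{\log n}{\sqrt d}$; if $B$ contains a cycle, then all vertices of $B$ are within distance $\log^5 d+2\frac{\log n}{\sqrt d}$ of the cycle. \textbf{The class $\mathcal G(d,\varepsilon)$.} With $\beta_c(d)=\sqrt{2\pi}/d$, $(G,\mathcal J,\beta)\in\mathcal G(d,\varepsilon)$ means: $0<\beta\le(1-\varepsilon)\beta_c(d)$; $G$ admits a $(d,\varepsilon)$-block partition; every path $P$ of length at most $\frac{\log n}{\log^4 d}$ satisfies $\beta\sum_{e}|J_e|+\sum_{v}\log\deg(v)\le\frac{\log n}{\log^2 d}$ (with $\log 0$ read as $0$), where $e$ ranges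 over the edges of $G$ with at least one endpoint on $P$ and $v$ over the vertices of $P$; and $n^{-7/3}\le|J_e|\le10\sqrt{\log n}$ for every edge $e$. \textbf{Dynamics.} The block dynamics for $\mathcal B$ chooses, at each discrete step, a uniformly random block $B\in\mathcal B$ and resamples the configuration on $B$ from $\mu$ conditional on the configuration outside $B$. The single-site dynamics on $B$ with boundary condition $\xi$ on $\partial_{\rm out}B$ has state space $\{\pm1\}^B$; at each discrete step it chooses a uniformly random vertex of $B$ and resamples its spin from its conditional law, given the other spins in $B$, under the marginal on $B$ of $\mu$ conditional on $\xi$. The relaxation time of a chain is $\frac1{1-\lambda^*}$, where $\lambda^*$ is the second largest eigenvalue in magnitude of its transition matrix. \textbf{Theorem.} For every $\varepsilon>0$ there is $d_0=d_0(\varepsilon)\ge1$ such that for every $d\ge d_0$ there are $C>0$ and $n_0$, depending only on $\varepsilon$ and $d$, such that for every $(G,\mathcal J,\beta)\in\mathcal G(d,\varepsilon)$ on $n\ge n_0$ vertices and every shallow $(d,\varepsilon)$-block partition $\mathcal B$ of $G$ the following holds. The block dynamics has relaxation time $\tau_{\rm block}\le C\,n\log n$; and for every block $B\in\mathcal B$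 (tree or unicyclic) and every boundary condition on $\partial_{\rm out}B$, the single-site dynamics on $B$ has relaxation time $\tau_B\le n^{3/\log^2 d}$. -/

import Mathlib

open scoped ENNReal

noncomputable section

namespace SpinGlass

/-- The spins `{±1}`. -/
abbrev Spin : Type := ℤˣ

/-! ### Markov chains on finite state spaces -/

section Chains

variable {Ω : Type*} [Fintype Ω]

/-- The second largest eigenvalue, in magnitude, of a (reversible) transition matrix `P`.
The largest one is the eigenvalue `1` of the constant functions, so the remaining ones, counted
with multiplicity, are those having a non-constant eigenfunction. -/
def secondEigenvalue (P : Matrix Ω Ω ℝ) : ℝ :=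
  sSup {r : ℝ | ∃ (l : ℝ) (f : Ω → ℝ),
    (¬ ∃ c : ℝ, ∀ x, f x = c) ∧ P.mulVec f = l • f ∧ r = |l|}

/-- The relaxation time `1 / (1 - λ*)`; it is `∞` if the absolute spectral gap vanishes. -/
def relaxationTime (P : Matrix Ω Ω ℝ) : ℝ≥0∞ :=
  (ENNReal.ofReal (1 - secondEigenvalue P))⁻¹

end Chains

section Dynamics

variable {S : Type*} [Fintype S]

open Classical in
/-- Heat-bath update of the set `B`: from `σ`, keep the configuration outside `B` and resample the
configuration on `B` from `μ` conditional on the configuration outside `B`. -/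
def updateKernel (μ : (S → Spin) → ℝ) (B : Finset S) (σ τ : S → Spin) : ℝ :=
  if ∀ v, v ∉ B → τ v = σ v then
    μ τ / ∑ τ' : S → Spin with (∀ v, v ∉ B → τ' v = σ v), μ τ'
  else 0

/-- Block dynamics: choose one of the blocks uniformly at random and update it. -/
def blockDynamics (μ : (S → Spin) → ℝ) (blocks : Finset (Finset S)) :
    Matrix (S → Spin) (S → Spin) ℝ :=
  fun σ τ => (blocks.card : ℝ)⁻¹ * ∑ B ∈ blocks, updateKernel μ B σ τ

/-- Single-site (Glauber) dynamics: choose a vertex uniformly at random and update it. -/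
def glauberDynamics (μ : (S → Spin) → ℝ) : Matrix (S → Spin) (S → Spin) ℝ :=
  fun σ τ => (Fintype.card S : ℝ)⁻¹ * ∑ v : S, updateKernel μ {v} σ τ

open Classical in
/-- The marginal of `μ` on `B`, conditional on the configuration on `Λ` being that of `ξ`. -/
def condMarginal (μ : (S → Spin) → ℝ) (Λ : Set S) (ξ : S → Spin) (B : Finset S)
    (η : {v // v ∈ B} → Spin) : ℝ :=
  (∑ τ : S → Spin with ((∀ v ∈ Λ, τ v = ξ v) ∧ ∀ v : {v // v ∈ B}, τ v = η v), μ τ) /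
    ∑ τ : S → Spin with (∀ v ∈ Λ, τ v = ξ v), μ τ

end Dynamics

/-! ### The Gibbs distribution and the weights -/

section Graph

variable {V : Type*} [Fintype V] (G : SimpleGraph V) (J : Sym2 V → ℝ) (β : ℝ)

open Classical in
/-- `exp (β ∑_{x ∼ y} 1{σ x = σ y} J_{xy})`.  Only the values of `J` on edges of `G` are used. -/
def gibbsWeight (σ : V → Spin) : ℝ :=
  Real.exp (β * ∑ e ∈ G.edgeFinset, if (e.map σ).IsDiag then J e else 0)

open Classical in
/-- The Gibbs distribution `μ_{G,J,β}` on `{±1}^V`. -/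
def gibbs (σ : V → Spin) : ℝ :=
  gibbsWeight G J β σ / ∑ τ : V → Spin, gibbsWeight G J β τ

/-- The influence of the edge `e`. -/
def edgeInfluence (e : Sym2 V) : ℝ :=
  |1 - Real.exp (β * J e)| / (1 + Real.exp (β * J e))

open Classical in
/-- The aggregate influence of the vertex `u`. -/
def aggregateInfluence (u : V) : ℝ :=
  ∑ w : V with G.Adj u w, edgeInfluence J β s(u, w)

/-- The `(d, ε)`-weight of a vertex. -/
def vertexWeight (d ε : ℝ) (u : V) : ℝ :=
  if aggregateInfluence G J β u ≤ 1 - ε / 2 then 1 - ε / 4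
  else d * aggregateInfluence G J β u

/-- The `(d, ε)`-weight of a path: the product of the weights of its vertices. -/
def pathWeight (d ε : ℝ) {u v : V} (p : G.Walk u v) : ℝ :=
  (p.support.map (vertexWeight G J β d ε)).prod

/-- `(d, ε)`-block vertices: all paths of length at most `log n` emanating from `u` have weight
less than `1`. -/
def IsBlockVertex (d ε : ℝ) (u : V) : Prop :=
  ∀ (v : V) (p : G.Walk u v), p.IsPath → (p.length : ℝ) ≤ Real.log (Fintype.card V) →
    pathWeight G J β d ε p < 1

open Classical in
/-- The weight `β ∑_e |J_e| + ∑_v log deg v` of a path: `e` ranges over the edges of `G` with at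
least one endpoint on the path, `v` over the vertices of the path. -/
def comparisonWeight {u v : V} (p : G.Walk u v) : ℝ :=
  β * (∑ e ∈ G.edgeFinset with (∃ x ∈ p.support, x ∈ e), |J e|) +
    ∑ x : V with x ∈ p.support, Real.log (G.degree x)

/-- The outer boundary: vertices outside `B` with a neighbour in `B`. -/
def outerBoundary (B : Finset V) : Set V :=
  {w | w ∉ B ∧ ∃ v ∈ B, G.Adj w v}

/-- A tree with at most one extra edge. -/
def IsTreeWithAtMostOneExtraEdge {W : Type*} (H : SimpleGraph W) : Prop :=
  ∃ T : SimpleGraph W, T.IsTree ∧ T ≤ H ∧ (H.edgeSet \ T.edgeSet).encard ≤ 1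

/-- The conditions on a single block `B` of a `(d, ε)`-block partition. -/
structure IsGoodBlock (d ε : ℝ) (B : Finset V) : Prop where
  shape : IsTreeWithAtMostOneExtraEdge (G.induce (B : Set V))
  boundary_block : 1 < B.card → ∀ w ∈ outerBoundary G B, IsBlockVertex G J β d ε w
  boundary_unique : 1 < B.card → ∀ w ∈ outerBoundary G B, ∃! v, v ∈ B ∧ G.Adj w v
  cycle_short : 1 < B.card →
    ∀ (v : (B : Set V)) (c : (G.induce (B : Set V)).Walk v v), c.IsCycle →
      (c.length : ℝ) ≤ 4 * (Real.log (Fintype.card V) / Real.log d ^ 4)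
  cycle_deep : 1 < B.card →
    ∀ (v : (B : Set V)) (c : (G.induce (B : Set V)).Walk v v), c.IsCycle →
      ∀ x ∈ c.support, ∀ w ∈ outerBoundary G B, Real.log d ^ 5 ≤ (G.dist x.1 w : ℝ)
  single : B.card = 1 → ∀ v ∈ B, IsBlockVertex G J β d ε v

/-- `(d, ε)`-block partitions. -/
def IsBlockPartition [DecidableEq V] (d ε : ℝ) (P : Finpartition (Finset.univ : Finset V)) :
    Prop :=
  ∀ B ∈ P.parts, IsGoodBlock G J β d ε B

/-- The blocks have low diameter, as in the construction of the block partition.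
Inside a multi-vertex tree block, all vertices are within distance `4 log n / √d` of some root;
inside a unicyclic block, all vertices are within distance `2 log n / √d` of the
`log⁵ d`-neighbourhood of the cycle.  Distances are measured in the subgraph induced by the
(connected) block. -/
def IsShallowPartition [DecidableEq V] (d : ℝ) (P : Finpartition (Finset.univ : Finset V)) :
    Prop :=
  ∀ B ∈ P.parts, 1 < B.card →
    ((G.induce (B : Set V)).IsAcyclic → ∃ r : (B : Set V), ∀ w : (B : Set V),
      ((G.induce (B : Set V)).dist r w : ℝ) ≤ 4 * (Real.log (Fintype.card V) / √d)) ∧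
    (∀ (v : (B : Set V)) (c : (G.induce (B : Set V)).Walk v v), c.IsCycle →
      ∀ w : (B : Set V), ∃ x ∈ c.support, ((G.induce (B : Set V)).dist x w : ℝ) ≤
        Real.log d ^ 5 + 2 * (Real.log (Fintype.card V) / √d))

/-- `β_c(d) = √(2π) / d`. -/
def criticalBeta (d : ℝ) : ℝ := √(2 * Real.pi) / d

/-- The set `𝒢(d, ε)` of triplets `(G, J, β)`. -/
structure InGoodClass [DecidableEq V] (d ε : ℝ) : Prop where
  beta_pos : 0 < β
  beta_le : β ≤ (1 - ε) * criticalBeta d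
  admits : ∃ P : Finpartition (Finset.univ : Finset V), IsBlockPartition G J β d ε P
  path_bound : ∀ (u v : V) (p : G.Walk u v), p.IsPath →
    (p.length : ℝ) ≤ Real.log (Fintype.card V) / Real.log d ^ 4 →
      comparisonWeight G J β p ≤ Real.log (Fintype.card V) / Real.log d ^ 2
  coupling_lower : ∀ e ∈ G.edgeSet, (Fintype.card V : ℝ) ^ (-(7 / 3) : ℝ) ≤ |J e|
  coupling_upper : ∀ e ∈ G.edgeSet, |J e| ≤ 10 * √(Real.log (Fintype.card V))

/-- The Gibbs distribution on the block `B` with the boundary condition `ξ` at the outer boundary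
of `B` (the values of `ξ` elsewhere play no role). -/
def blockGibbs (B : Finset V) (ξ : V → Spin) : ({v // v ∈ B} → Spin) → ℝ :=
  condMarginal (gibbs G J β) (outerBoundary G B) ξ B

end Graph

end SpinGlass

end

set_option linter.unusedSectionVars false

/-! Both bounds come from following self-avoiding paths inside a block: influence spreads along them
in the block dynamics, and vertices are eliminated along them in the single-site dynamics.

Block dynamics. Let f be a nonconstant eigenfunction with eigenvalue l, Δ(v) its largest change
under a flip at v, φ(v) the sum of Γ over the edges from v that leave its block, and X the maximum
of Δ/φ. Updating the block of w makes a flip at w invisible. Updating another block B changes the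
conditional mean of f by at most Δ(w) plus the sum, over neighbours u of w in B, of Γ_{wu} times the
influence of u on the rest of B. A flip at u acts on B∖{u} as a change of external field at its
neighbours, so its influence obeys a recursion along self-avoiding paths
(`abs_condExp_flip_sub_le`). Since Δ ≤ Xφ, and φ(u) plus the Γ's from u into B∖{u} is at most A(u),
the recursion closes at X times the largest product of A along a path of B from u
(`abs_condExp_flip_sub_le_of_paths`). If |B| ≥ 2, such a path prefixed with a block vertex outside B
has weight M below 1, and the slack between A and M brings its product under κ = (1-ε/2)/(1-ε/4)² <
1 (`prod_aggregateInfluence_le`); a singleton is itself a block vertex. At a maximiser w of Δ/φ this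
reads |l| ≤ 1-(1-κ)/N with N blocks, so the relaxation time is even O(n).

Single-site dynamics. The estimates are Poincaré inequalities uniform in the configuration outside.
Deleting edges costs a factor exp(β∑|J_e|) (`IsPoincare.of_deleteEdges`), and sets not joined by an
edge tensorise at no cost (`IsPoincare.union`). Detaching a root, next a root of each remaining
piece, and so on, is charged only along one path, so the constant is at most the exponential of the
largest path weight (`isPoincare_of_paths`). At most 18 cuts leave a shallow block with short paths
only (`shallow_block_structure`); the cuts cost exp(O(√log n)), and the path bound of the class
yields n^{1/log² d}. The size of the block contributes n^{1/log² d} up to powers of log n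
(`card_block_le`), and the third factor n^{1/log² d} absorbs the rest. -/

namespace SpinGlass

/-! ### Conditional expectations given the configuration off a set. -/

section Fibers

variable {S : Type*} [Fintype S]

open Classical in
/-- The configurations that agree with `σ` off `A`. -/
noncomputable def fiber (A : Finset S) (σ : S → Spin) : Finset (S → Spin) :=
  Finset.univ.filter fun τ => ∀ v, v ∉ A → τ v = σ v

lemma mem_fiber {A : Finset S} {σ τ : S → Spin} : τ ∈ fiber A σ ↔ ∀ v, v ∉ A → τ v = σ v := by
  simp [fiber]

lemma self_mem_fiber (A : Finset S) (σ : S → Spin) : σ ∈ fiber A σ :=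
  mem_fiber.2 fun _ _ => rfl

lemma fiber_nonempty (A : Finset S) (σ : S → Spin) : (fiber A σ).Nonempty :=
  ⟨σ, self_mem_fiber A σ⟩

lemma fiber_congr {A : Finset S} {σ τ : S → Spin} (h : ∀ v, v ∉ A → τ v = σ v) :
    fiber A τ = fiber A σ := by
  ext ρ
  simp only [mem_fiber]
  exact forall₂_congr fun v hv => by rw [h v hv]

lemma fiber_eq_of_mem {A : Finset S} {σ τ : S → Spin} (h : τ ∈ fiber A σ) :
    fiber A τ = fiber A σ :=
  fiber_congr (mem_fiber.1 h)

lemma fiber_mono {A B : Finset S} (h : A ⊆ B) (σ : S → Spin) : fiber A σ ⊆ fiber B σ := by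
  intro τ hτ
  exact mem_fiber.2 fun v hv => mem_fiber.1 hτ v fun hA => hv (h hA)

lemma mem_fiber_comm {A : Finset S} {σ τ : S → Spin} : τ ∈ fiber A σ ↔ σ ∈ fiber A τ := by
  simp only [mem_fiber]
  exact forall₂_congr fun v _ => eq_comm

/-- The total weight of a fiber. -/
noncomputable def fiberMass (W : (S → Spin) → ℝ) (A : Finset S) (σ : S → Spin) : ℝ :=
  ∑ τ ∈ fiber A σ, W τ

/-- The conditional expectation of `f` given the configuration off `A`. -/
noncomputable def condExp (W : (S → Spin) → ℝ) (A : Finset S) (f : (S → Spin) → ℝ)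
    (σ : S → Spin) : ℝ :=
  (∑ τ ∈ fiber A σ, W τ * f τ) / fiberMass W A σ

variable {W : (S → Spin) → ℝ}

lemma fiberMass_pos (hW : ∀ σ, 0 < W σ) (A : Finset S) (σ : S → Spin) : 0 < fiberMass W A σ :=
  Finset.sum_pos (fun τ _ => hW τ) (fiber_nonempty A σ)

lemma fiberMass_congr {A : Finset S} {σ τ : S → Spin} (h : τ ∈ fiber A σ) :
    fiberMass W A τ = fiberMass W A σ := by
  unfold fiberMass; rw [fiber_eq_of_mem h]

lemma condExp_congr {A : Finset S} {f : (S → Spin) → ℝ} {σ τ : S → Spin} (h : τ ∈ fiber A σ) :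
    condExp W A f τ = condExp W A f σ := by
  unfold condExp; rw [fiberMass_congr h, fiber_eq_of_mem h]

lemma sum_updateKernel_mul [DecidableEq S] (W : (S → Spin) → ℝ) (A : Finset S) (f : (S → Spin) → ℝ)
    (σ : S → Spin) : ∑ τ, updateKernel W A σ τ * f τ = condExp W A f σ := by
  have key : ∀ τ, updateKernel W A σ τ * f τ =
      if τ ∈ fiber A σ then W τ * f τ / fiberMass W A σ else 0 := by
    intro τ
    unfold updateKernel fiberMass
    simp only [mem_fiber]
    split_ifs with h
    · rw [div_mul_eq_mul_div]
      congr 1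
    · simp
  simp only [key]
  rw [← Finset.sum_filter, ← Finset.sum_div, Finset.filter_mem_eq_inter, Finset.univ_inter]
  rfl

lemma condExp_const_mul {c : ℝ} (hc : c ≠ 0) (A : Finset S) (f : (S → Spin) → ℝ)
    (σ : S → Spin) : condExp (fun τ => c * W τ) A f σ = condExp W A f σ := by
  unfold condExp fiberMass
  simp only [mul_assoc]
  rw [← Finset.mul_sum, ← Finset.mul_sum, mul_div_mul_left _ _ hc]

lemma condExp_abs_sub_le (hW : ∀ σ, 0 < W σ) (A : Finset S) {f g : (S → Spin) → ℝ}
    (σ : S → Spin) {D : ℝ} (h : ∀ τ, |f τ - g τ| ≤ D) :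
    |condExp W A f σ - condExp W A g σ| ≤ D := by
  have hm := fiberMass_pos hW A σ
  unfold condExp
  rw [← sub_div, ← Finset.sum_sub_distrib, abs_div, abs_of_pos hm, div_le_iff₀ hm]
  refine (Finset.abs_sum_le_sum_abs _ _).trans ?_
  unfold fiberMass
  rw [Finset.mul_sum]
  refine Finset.sum_le_sum fun τ _ => ?_
  rw [← mul_sub, abs_mul, abs_of_pos (hW τ), mul_comm]
  exact mul_le_mul_of_nonneg_right (h τ) (hW τ).le

variable [DecidableEq S]

/-- Reverse the spin at `v`. -/
def flip (v : S) (σ : S → Spin) : S → Spin := Function.update σ v (-σ v)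

@[simp] lemma flip_self (v : S) (σ : S → Spin) : flip v σ v = -σ v := by simp [flip]

lemma flip_of_ne {u v : S} (h : u ≠ v) (σ : S → Spin) : flip v σ u = σ u := by simp [flip, h]

@[simp] lemma flip_flip (v : S) (σ : S → Spin) : flip v (flip v σ) = σ := by
  ext u
  by_cases h : u = v
  · subst h; simp
  · simp [flip_of_ne h]

lemma flip_mem_fiber {v : S} {A : Finset S} (h : v ∈ A) (σ : S → Spin) : flip v σ ∈ fiber A σ :=
  mem_fiber.2 fun u hu => flip_of_ne (fun e : u = v => hu (e ▸ h)) σ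

lemma flip_mem_fiber_flip {v : S} {A : Finset S} (σ τ : S → Spin) :
    flip v τ ∈ fiber A (flip v σ) ↔ τ ∈ fiber A σ := by
  simp only [mem_fiber]
  refine forall₂_congr fun u _ => ?_
  by_cases hu : u = v
  · subst hu; simp
  · simp [flip_of_ne hu]

lemma sum_fiber_flip (v : S) (A : Finset S) (σ : S → Spin) (g : (S → Spin) → ℝ) :
    ∑ τ ∈ fiber A (flip v σ), g τ = ∑ τ ∈ fiber A σ, g (flip v τ) := by
  refine Finset.sum_nbij' (flip v) (flip v) ?_ ?_ ?_ ?_ ?_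
  · intro τ hτ
    rw [← flip_mem_fiber_flip (v := v), flip_flip]; exact hτ
  · intro τ hτ
    rwa [flip_mem_fiber_flip]
  · simp
  · simp
  · simp

lemma sum_fiber_erase {u : S} {A : Finset S} (hu : u ∈ A) (σ : S → Spin)
    (g : (S → Spin) → ℝ) :
    ∑ τ ∈ fiber A σ, g τ = ∑ τ ∈ fiber (A.erase u) (Function.update σ u 1), g τ +
      ∑ τ ∈ fiber (A.erase u) (Function.update σ u (-1)), g τ := by
  have key : ∀ s : Spin, (fiber A σ).filter (fun τ => τ u = s) =
      fiber (A.erase u) (Function.update σ u s) := by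
    intro s
    ext τ
    simp only [Finset.mem_filter, mem_fiber, Finset.mem_erase, not_and]
    constructor
    · rintro ⟨h1, h2⟩ v hv
      by_cases hvu : v = u
      · subst hvu; simpa using h2
      · simpa [hvu] using h1 v (hv hvu)
    · intro h
      refine ⟨fun v hv => ?_, by simpa using h u (fun h' => absurd rfl h')⟩
      have hvu : v ≠ u := fun e => hv (e ▸ hu)
      simpa [hvu] using h v fun _ => hv
  rw [← key, ← key, ← Finset.sum_filter_add_sum_filter_not (fiber A σ) (fun τ => τ u = 1)]
  congr 1
  refine Finset.sum_congr (Finset.filter_congr fun τ _ => ?_) fun _ _ => rfl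
  rcases Int.units_eq_one_or (τ u) with h | h <;> simp [h]

end Fibers

/-! ### Sensitivity of conditional expectations to external fields. -/

/-- The spin at `u` as a real number. -/
def spinVal {S : Type*} (τ : S → Spin) (u : S) : ℝ := ((τ u : ℤ) : ℝ)

lemma spinVal_sq {S : Type*} (τ : S → Spin) (u : S) : spinVal τ u = 1 ∨ spinVal τ u = -1 := by
  unfold spinVal
  rcases Int.units_eq_one_or (τ u) with h | h <;> simp [h]

/-- `tanh (|c| / 2)`, written with exponentials. -/
noncomputable def tiltInfluence (c : ℝ) : ℝ := |1 - Real.exp c| / (1 + Real.exp c)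

lemma tiltInfluence_nonneg (c : ℝ) : 0 ≤ tiltInfluence c := by unfold tiltInfluence; positivity

lemma tiltInfluence_neg (c : ℝ) : tiltInfluence (-c) = tiltInfluence c := by
  unfold tiltInfluence
  rw [Real.exp_neg]
  have h := Real.exp_pos c
  have : 1 - (Real.exp c)⁻¹ = -(1 - Real.exp c) / Real.exp c := by field_simp; ring
  rw [this, abs_div, abs_neg, abs_of_pos h]
  field_simp
  ring

/-- The exact coefficient of |x - y| is ab|1-t|(1+t)/((a+b)(at²+b)), and (a+b)(at²+b) - ab(1+t)² =
(at-b)². The bound is thus attained when b = at. -/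
lemma abs_weighted_mean_tilt_sub_le {a b t : ℝ} (ha : 0 < a) (hb : 0 < b) (ht : 0 < t) (x y : ℝ) :
    |(a * t * x + b * t⁻¹ * y) / (a * t + b * t⁻¹) - (a * x + b * y) / (a + b)| ≤
      |1 - t| / (1 + t) * |x - y| := by
  have e : (a * t * x + b * t⁻¹ * y) / (a * t + b * t⁻¹) - (a * x + b * y) / (a + b) =
      (a * b * (1 + t) / ((a + b) * (a * t ^ 2 + b))) * (-(1 - t)) * (x - y) := by
    have h1 : a * t ^ 2 + b ≠ 0 := by positivity
    have h2 : a * t + b * t⁻¹ = (a * t ^ 2 + b) / t := by field_simp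
    have h3 : a * t * x + b * t⁻¹ * y = (a * t ^ 2 * x + b * y) / t := by field_simp
    rw [h2, h3, div_div_div_cancel_right₀ ht.ne', div_sub_div _ _ h1 (by positivity)]
    field_simp
    ring
  rw [e, abs_mul, abs_mul, abs_neg]
  refine mul_le_mul_of_nonneg_right ?_ (abs_nonneg _)
  rw [div_eq_inv_mul |1 - t|]
  refine mul_le_mul_of_nonneg_right ?_ (abs_nonneg _)
  rw [abs_of_pos (by positivity), div_le_iff₀ (by positivity), inv_mul_eq_div,
    le_div_iff₀ (by positivity)]
  nlinarith [sq_nonneg (a * t - b), mul_pos ha hb]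

section Tilt

variable {S : Type*} [Fintype S] [DecidableEq S] {W : (S → Spin) → ℝ}

lemma condExp_eq_erase (hW : ∀ σ, 0 < W σ) {u : S} {A : Finset S} (hu : u ∈ A)
    (f : (S → Spin) → ℝ) (σ : S → Spin) :
    condExp W A f σ =
      (fiberMass W (A.erase u) (Function.update σ u 1) *
          condExp W (A.erase u) f (Function.update σ u 1) +
        fiberMass W (A.erase u) (Function.update σ u (-1)) *
          condExp W (A.erase u) f (Function.update σ u (-1))) /
      (fiberMass W (A.erase u) (Function.update σ u 1) +
        fiberMass W (A.erase u) (Function.update σ u (-1))) := by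
  unfold condExp
  rw [mul_div_cancel₀ _ (fiberMass_pos hW _ _).ne', mul_div_cancel₀ _ (fiberMass_pos hW _ _).ne',
    sum_fiber_erase hu]
  congr 1
  unfold fiberMass
  exact sum_fiber_erase hu σ W

/-- Changing the external field at one vertex. -/
lemma abs_condExp_tilt_sub_le (hW : ∀ σ, 0 < W σ) {u : S} {A : Finset S} (hu : u ∈ A) (δ : ℝ)
    (f : (S → Spin) → ℝ) (σ : S → Spin) :
    |condExp (fun τ => W τ * Real.exp (δ * spinVal τ u)) A f σ - condExp W A f σ| ≤
      tiltInfluence δ * |condExp W (A.erase u) f (Function.update σ u 1) -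
        condExp W (A.erase u) f (Function.update σ u (-1))| := by
  have hW' : ∀ τ, 0 < W τ * Real.exp (δ * spinVal τ u) := fun τ => mul_pos (hW τ) (Real.exp_pos _)
  have val : ∀ (s : Spin), ∀ τ ∈ fiber (A.erase u) (Function.update σ u s),
      spinVal τ u = ((s : ℤ) : ℝ) := by
    intro s τ hτ
    have := mem_fiber.1 hτ u (by simp)
    simp [spinVal, this]
  have hm : ∀ s : Spin, fiberMass (fun τ => W τ * Real.exp (δ * spinVal τ u)) (A.erase u)
      (Function.update σ u s) =
      fiberMass W (A.erase u) (Function.update σ u s) * Real.exp (δ * ((s : ℤ) : ℝ)) := by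
    intro s
    unfold fiberMass
    rw [Finset.sum_mul]
    exact Finset.sum_congr rfl fun τ hτ => by beta_reduce; rw [val s τ hτ]
  -- Once the spin at `u` is fixed, the tilt is a constant factor and cancels. Only the masses of
  -- the two halves of the fiber change.
  have hc : ∀ s : Spin, condExp (fun τ => W τ * Real.exp (δ * spinVal τ u)) (A.erase u) f
      (Function.update σ u s) = condExp W (A.erase u) f (Function.update σ u s) := by
    intro s
    rw [← condExp_const_mul (W := W) (Real.exp_pos (δ * ((s : ℤ) : ℝ))).ne']
    unfold condExp fiberMass
    congr 1 <;>
    exact Finset.sum_congr rfl fun τ hτ => by beta_reduce; rw [val s τ hτ]; ring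
  rw [condExp_eq_erase hW' hu, condExp_eq_erase hW hu, hm, hm, hc, hc]
  have := abs_weighted_mean_tilt_sub_le
    (fiberMass_pos hW (A.erase u) (Function.update σ u 1))
    (fiberMass_pos hW (A.erase u) (Function.update σ u (-1))) (Real.exp_pos δ)
    (condExp W (A.erase u) f (Function.update σ u 1))
    (condExp W (A.erase u) f (Function.update σ u (-1)))
  simpa [tiltInfluence, Real.exp_neg] using this

/-- The weight `W` tilted by the external field `h`. -/
noncomputable def fieldWeight (W : (S → Spin) → ℝ) (h : S → ℝ) (τ : S → Spin) : ℝ :=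
  W τ * Real.exp (∑ u, h u * spinVal τ u)

lemma fieldWeight_pos (hW : ∀ σ, 0 < W σ) (h : S → ℝ) (τ : S → Spin) : 0 < fieldWeight W h τ :=
  mul_pos (hW τ) (Real.exp_pos _)

lemma fieldWeight_add_single (W : (S → Spin) → ℝ) (h : S → ℝ) (u : S) (δ : ℝ) :
    fieldWeight W (h + Pi.single u δ) =
      fun τ => fieldWeight W h τ * Real.exp (δ * spinVal τ u) := by
  funext τ
  unfold fieldWeight
  rw [mul_assoc, ← Real.exp_add]
  simp [add_mul, Finset.sum_add_distrib, Pi.single_apply]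

lemma abs_update_sub_le {g : (S → Spin) → ℝ} {u : S} {b : ℝ}
    (h : ∀ ρ, |g (flip u ρ) - g ρ| ≤ b) (σ : S → Spin) :
    |g (Function.update σ u 1) - g (Function.update σ u (-1))| ≤ b := by
  have := h (Function.update σ u (-1))
  simpa [flip] using this

/-- Changing the external field at several vertices of `A`. -/
lemma abs_condExp_field_sub_le (hW : ∀ σ, 0 < W σ) {A : Finset S} (f : (S → Spin) → ℝ)
    (b δ : S → ℝ) (N : Finset S) (hN : N ⊆ A)
    (hb : ∀ u ∈ N, ∀ h ρ, |condExp (fieldWeight W h) (A.erase u) f (flip u ρ) -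
      condExp (fieldWeight W h) (A.erase u) f ρ| ≤ b u) (h : S → ℝ) (σ : S → Spin) :
    |condExp (fieldWeight W (h + ∑ u ∈ N, Pi.single u (δ u))) A f σ -
      condExp (fieldWeight W h) A f σ| ≤ ∑ u ∈ N, tiltInfluence (δ u) * b u := by
  induction N using Finset.induction_on with
  | empty => simp
  | insert u N hu ih =>
    rw [Finset.sum_insert hu, Finset.sum_insert hu,
      add_comm (Pi.single u (δ u) : S → ℝ), ← add_assoc]
    have h1 := ih (fun x hx => hN (Finset.mem_insert_of_mem hx))
      (fun x hx => hb x (Finset.mem_insert_of_mem hx))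
    -- Each new field is added on top of the earlier ones, which is why `hb` is required for every
    -- field `h`.
    have h2 := abs_condExp_tilt_sub_le (fieldWeight_pos hW (h + ∑ u ∈ N, Pi.single u (δ u)))
      (hN (Finset.mem_insert_self u N)) (δ u) f σ
    rw [← fieldWeight_add_single] at h2
    have h3 := abs_update_sub_le
      (hb u (Finset.mem_insert_self u N) (h + ∑ u ∈ N, Pi.single u (δ u))) σ
    have h4 := h2.trans (mul_le_mul_of_nonneg_left h3 (tiltInfluence_nonneg (δ u)))
    exact (abs_sub_le _ _ _).trans (add_le_add h4 h1)

end Tilt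

end SpinGlass

namespace SpinGlass

/-! ### Propagation of a spin flip through a block. -/

section Influence

variable {V : Type*} [Fintype V] [DecidableEq V] (G : SimpleGraph V) (J : Sym2 V → ℝ) (β : ℝ)

open Classical in
lemma sum_edgeFinset_eq_sum_neighbors (v : V) (g : Sym2 V → ℝ) (hg : ∀ e, v ∉ e → g e = 0) :
    ∑ e ∈ G.edgeFinset, g e = ∑ u : V with G.Adj v u, g s(v, u) := by
  have hinj : Set.InjOn (fun u => s(v, u)) (↑(Finset.univ.filter fun u => G.Adj v u) : Set V) := by
    intro a _ b _ hab
    exact Sym2.congr_right.1 hab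
  rw [← Finset.sum_image (f := g) hinj]
  symm
  refine Finset.sum_subset ?_ ?_
  · intro e he
    obtain ⟨u, hu, rfl⟩ := Finset.mem_image.1 he
    simpa using hu
  · intro e he hne
    apply hg
    intro hv
    apply hne
    obtain ⟨u, rfl⟩ := Sym2.mem_iff_exists.1 hv
    exact Finset.mem_image.2 ⟨u, by simpa using he, rfl⟩

lemma gibbsWeight_pos (σ : V → Spin) : 0 < gibbsWeight G J β σ := Real.exp_pos _

lemma sum_gibbsWeight_pos : 0 < ∑ τ : V → Spin, gibbsWeight G J β τ :=
  Finset.sum_pos (fun τ _ => gibbsWeight_pos G J β τ) Finset.univ_nonempty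

-- Only the edges at v react, and on them 1{σ(v)=σ(u)} = (1+σ(v)σ(u))/2 changes by -σ(v)σ(u). The
-- field on a neighbour therefore moves by βJ, which is why Γ is `tiltInfluence (β * J e)`.
open Classical in
lemma energy_flip (v : V) (σ : V → Spin) :
    (∑ e ∈ G.edgeFinset, if (e.map (flip v σ)).IsDiag then J e else 0) =
      (∑ e ∈ G.edgeFinset, if (e.map σ).IsDiag then J e else 0) -
        ∑ u : V with G.Adj v u, J s(v, u) * spinVal σ v * spinVal σ u := by
  rw [eq_sub_iff_add_eq', ← eq_sub_iff_add_eq, ← Finset.sum_sub_distrib,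
    sum_edgeFinset_eq_sum_neighbors G v]
  · refine Finset.sum_congr rfl fun u hu => ?_
    have huv : u ≠ v := by
      rintro rfl
      simp at hu
    simp only [Sym2.map_mk, Sym2.mk_isDiag_iff, flip_self, flip_of_ne huv, spinVal]
    rcases Int.units_eq_one_or (σ v) with h | h <;> rcases Int.units_eq_one_or (σ u) with h' | h' <;>
      simp [h, h']
  · intro e he
    have : e.map (flip v σ) = e.map σ := by
      refine Sym2.map_congr fun x hx => flip_of_ne ?_ σ
      rintro rfl
      exact he hx
    rw [this, sub_self]

open Classical in
/-- Seen from `A`, reversing the spin at `v ∉ A` changes the external field at the neighbours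
of `v`. -/
lemma fieldWeight_flip {A : Finset V} {v : V} (hv : v ∉ A) (h : V → ℝ) (σ : V → Spin) :
    ∃ c : ℝ, c ≠ 0 ∧ ∀ τ ∈ fiber A σ,
      fieldWeight (gibbsWeight G J β) h (flip v τ) =
        c * fieldWeight (gibbsWeight G J β) (h + ∑ u ∈ A.filter (fun u => G.Adj v u),
          Pi.single u (-(β * J s(v, u)) * spinVal σ v)) τ := by
  -- The constant collects what does not vary over the fiber: the field at `v` itself, and the edges
  -- from `v` to vertices off `A`.
  refine ⟨Real.exp (-2 * h v * spinVal σ v - β * ∑ u : V with G.Adj v u ∧ u ∉ A,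
    J s(v, u) * spinVal σ v * spinVal σ u), (Real.exp_pos _).ne', fun τ hτ => ?_⟩
  have hτv : τ v = σ v := mem_fiber.1 hτ v hv
  have hs : spinVal τ v = spinVal σ v := by simp [spinVal, hτv]
  unfold fieldWeight gibbsWeight
  rw [← Real.exp_add, ← Real.exp_add, ← Real.exp_add, energy_flip]
  congr 1
  have e1 : ∑ u, h u * spinVal (flip v τ) u = ∑ u, h u * spinVal τ u - 2 * h v * spinVal σ v := by
    rw [eq_sub_iff_add_eq', ← eq_sub_iff_add_eq, ← Finset.sum_sub_distrib,
      Finset.sum_eq_single v]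
    · simp [spinVal, hτv]; ring
    · intro u _ hu
      simp [spinVal, flip_of_ne hu]
    · simp
  have e2 : ∑ u, (h + ∑ u ∈ A.filter (fun u => G.Adj v u),
      (Pi.single u (-(β * J s(v, u)) * spinVal σ v) : V → ℝ)) u * spinVal τ u =
      ∑ u, h u * spinVal τ u - β * ∑ u : V with G.Adj v u ∧ u ∈ A,
        J s(v, u) * spinVal σ v * spinVal τ u := by
    have : ∀ u, (h + ∑ u ∈ A.filter (fun u => G.Adj v u),
      (Pi.single u (-(β * J s(v, u)) * spinVal σ v) : V → ℝ)) u * spinVal τ u =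
        h u * spinVal τ u + if G.Adj v u ∧ u ∈ A then
          -β * (J s(v, u) * spinVal σ v * spinVal τ u) else 0 := by
      intro u
      rw [Pi.add_apply, Finset.sum_apply, add_mul]
      congr 1
      simp only [Pi.single_apply, Finset.sum_ite_eq, Finset.mem_filter]
      by_cases h1 : u ∈ A <;> by_cases h2 : G.Adj v u <;> simp [h1, h2]
      ring
    simp only [this]
    rw [Finset.sum_add_distrib, ← Finset.sum_filter, ← Finset.mul_sum]
    ring
  rw [e1, e2, hs]
  have e3 : ∑ u : V with G.Adj v u, J s(v, u) * spinVal σ v * spinVal τ u =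
      ∑ u : V with G.Adj v u ∧ u ∈ A, J s(v, u) * spinVal σ v * spinVal τ u +
      ∑ u : V with G.Adj v u ∧ u ∉ A, J s(v, u) * spinVal σ v * spinVal σ u := by
    rw [← Finset.sum_filter_add_sum_filter_not _ (fun u => u ∈ A), Finset.filter_filter,
      Finset.filter_filter]
    congr 1
    refine Finset.sum_congr rfl fun u hu => ?_
    simp only [Finset.mem_filter] at hu
    simp [spinVal, mem_fiber.1 hτ u hu.2.2]
  rw [e3]
  ring

lemma edgeInfluence_eq (e : Sym2 V) : edgeInfluence J β e = tiltInfluence (β * J e) := rfl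

lemma edgeInfluence_nonneg (e : Sym2 V) : 0 ≤ edgeInfluence J β e := tiltInfluence_nonneg _

open Classical in
/-- The influence of the spin at `v ∉ A` on the law of the configuration on `A`, in terms of the
influences of the neighbours of `v`. -/
lemma abs_condExp_flip_sub_le {A : Finset V} {v : V} (hv : v ∉ A) (f : (V → Spin) → ℝ) {Δ : ℝ}
    (hΔ : ∀ ρ, |f (flip v ρ) - f ρ| ≤ Δ) (b : V → ℝ)
    (hb : ∀ u ∈ A, G.Adj v u → ∀ h ρ,
      |condExp (fieldWeight (gibbsWeight G J β) h) (A.erase u) f (flip u ρ) -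
        condExp (fieldWeight (gibbsWeight G J β) h) (A.erase u) f ρ| ≤ b u)
    (h : V → ℝ) (σ : V → Spin) :
    |condExp (fieldWeight (gibbsWeight G J β) h) A f (flip v σ) -
      condExp (fieldWeight (gibbsWeight G J β) h) A f σ| ≤
        Δ + ∑ u ∈ A.filter (fun u => G.Adj v u), edgeInfluence J β s(v, u) * b u := by
  have hW := gibbsWeight_pos G J β
  obtain ⟨c, hc, hcW⟩ := fieldWeight_flip G J β hv h σ
  set h' := h + ∑ u ∈ A.filter (fun u => G.Adj v u),
    (Pi.single u (-(β * J s(v, u)) * spinVal σ v) : V → ℝ) with hh'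
  -- The flip is moved from the boundary condition into the summand. What remains are two separate
  -- errors: replacing f ∘ flip by f costs Δ, and changing the field costs the sum over neighbours.
  have e1 : condExp (fieldWeight (gibbsWeight G J β) h) A f (flip v σ) =
      condExp (fieldWeight (gibbsWeight G J β) h') A (fun τ => f (flip v τ)) σ := by
    rw [← condExp_const_mul (W := fieldWeight (gibbsWeight G J β) h') hc]
    unfold condExp fiberMass
    rw [sum_fiber_flip, sum_fiber_flip]
    congr 1 <;> exact Finset.sum_congr rfl fun τ hτ => by rw [hcW τ hτ]
  have h1 := condExp_abs_sub_le (fieldWeight_pos hW h') A σ hΔ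
  have h2 := abs_condExp_field_sub_le hW f b (fun u => -(β * J s(v, u)) * spinVal σ v)
    (A.filter fun u => G.Adj v u) (Finset.filter_subset _ _)
    (fun u hu => hb u (Finset.mem_filter.1 hu).1 (Finset.mem_filter.1 hu).2) h σ
  rw [e1]
  refine (abs_sub_le _ _ _).trans (add_le_add h1 (h2.trans (le_of_eq ?_)))
  refine Finset.sum_congr rfl fun u _ => ?_
  rw [edgeInfluence_eq]
  rcases spinVal_sq σ v with h | h <;> simp [h, tiltInfluence_neg]

open Classical in
/-- The part of the aggregate influence of `u` which leaves `B`. -/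
noncomputable def outInfluence (B : Finset V) (u : V) : ℝ :=
  ∑ w : V with G.Adj u w ∧ w ∉ B, edgeInfluence J β s(u, w)

lemma outInfluence_nonneg (B : Finset V) (u : V) : 0 ≤ outInfluence G J β B u :=
  Finset.sum_nonneg fun _ _ => edgeInfluence_nonneg _ _ _

lemma aggregateInfluence_nonneg (u : V) : 0 ≤ aggregateInfluence G J β u :=
  Finset.sum_nonneg fun _ _ => edgeInfluence_nonneg _ _ _

open Classical in
lemma outInfluence_add_le {B A : Finset V} (hA : A ⊆ B) (u : V) :
    outInfluence G J β B u + ∑ w ∈ A.filter (fun w => G.Adj u w), edgeInfluence J β s(u, w) ≤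
      aggregateInfluence G J β u := by
  unfold outInfluence aggregateInfluence
  rw [← Finset.sum_union]
  · refine Finset.sum_le_sum_of_subset_of_nonneg ?_ fun _ _ _ => edgeInfluence_nonneg _ _ _
    intro w hw
    simp only [Finset.mem_union, Finset.mem_filter, Finset.mem_univ, true_and] at hw ⊢
    rcases hw with h | h
    · exact h.1
    · exact h.2
  · rw [Finset.disjoint_left]
    intro w hw hw'
    simp only [Finset.mem_filter, Finset.mem_univ, true_and] at hw hw'
    exact hw.2 (hA hw'.1)

/-- If the aggregate influences along every path of `B` starting at `v` multiply to at most `K`,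
then the influence of `v` on a function whose oscillations are dominated by the influences
leaving `B` is at most `K`. -/
lemma abs_condExp_flip_sub_le_of_paths {B : Finset V}
    (hpos : ∀ u w, G.Adj u w → 0 < edgeInfluence J β s(u, w)) (f : (V → Spin) → ℝ) {X : ℝ} (hX : 0 ≤ X)
    (hf : ∀ u ∈ B, ∀ ρ, |f (flip u ρ) - f ρ| ≤ X * outInfluence G J β B u)
    (A : Finset V) : ∀ (v : V) (K : ℝ), A ⊆ B → v ∈ B → v ∉ A →
    (∀ (x : V) (p : G.Walk v x), p.IsPath → (∀ y ∈ p.support, y ∈ insert v A) →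
      (p.support.map (aggregateInfluence G J β)).prod ≤ K) →
    ∀ h σ, |condExp (fieldWeight (gibbsWeight G J β) h) A f (flip v σ) -
      condExp (fieldWeight (gibbsWeight G J β) h) A f σ| ≤ X * K := by
  classical
  induction A using Finset.strongInduction with
  | H A ih =>
  intro v K hAB hvB hvA hK h σ
  have hAK : aggregateInfluence G J β v ≤ K := by
    simpa using hK v SimpleGraph.Walk.nil (by simp) (by simp)
  have h0 := aggregateInfluence_nonneg G J β v
  have hb : ∀ u ∈ A, G.Adj v u → ∀ h ρ,
      |condExp (fieldWeight (gibbsWeight G J β) h) (A.erase u) f (flip u ρ) -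
        condExp (fieldWeight (gibbsWeight G J β) h) (A.erase u) f ρ| ≤
          X * (K / aggregateInfluence G J β v) := by
    intro u hu huv
    -- Prepending `v` to a path from `u` multiplies its product by A(v), so K / A(v) is the bound
    -- left for paths from `u`. Erasing `u` from `A` keeps the paths self-avoiding.
    refine ih _ (Finset.erase_ssubset hu) u _ ((Finset.erase_subset _ _).trans hAB) (hAB hu)
      (Finset.notMem_erase _ _) ?_
    intro x p hp hpA
    rw [Finset.insert_erase hu] at hpA
    have hpath : (SimpleGraph.Walk.cons huv p).IsPath :=
      SimpleGraph.Walk.IsPath.cons hp fun hmem => hvA (hpA v hmem)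
    have := hK x (SimpleGraph.Walk.cons huv p) hpath (by
      intro y hy
      rw [SimpleGraph.Walk.support_cons, List.mem_cons] at hy
      rcases hy with rfl | hy
      · exact Finset.mem_insert_self _ _
      · exact Finset.mem_insert_of_mem (hpA y hy))
    rw [SimpleGraph.Walk.support_cons, List.map_cons, List.prod_cons] at this
    have h0' : 0 < aggregateInfluence G J β v :=
      Finset.sum_pos' (fun _ _ => edgeInfluence_nonneg _ _ _)
        ⟨u, by simpa using huv, hpos v u huv⟩
    rwa [le_div_iff₀' h0']
  have hstep := abs_condExp_flip_sub_le G J β hvA f (hf v hvB) _ hb h σ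
  refine hstep.trans ?_
  rw [← Finset.sum_mul]
  have hout := outInfluence_nonneg G J β B v
  have hle := outInfluence_add_le G J β hAB v
  set a := aggregateInfluence G J β v
  set s := ∑ w ∈ A.filter (fun w => G.Adj v w), edgeInfluence J β s(v, w)
  have hs : 0 ≤ s := Finset.sum_nonneg fun _ _ => edgeInfluence_nonneg _ _ _
  -- If A(v) = 0, the outgoing influence vanishes and K / A(v) is 0 by convention.
  rcases h0.eq_or_lt with h0' | h0'
  · have h1 : outInfluence G J β B v = 0 := by linarith
    rw [h1, ← h0']
    simpa using mul_nonneg hX (h0.trans hAK)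
  -- The trivial path gives A(v) ≤ K, so the direct effect X·out(v) may be enlarged by K / A(v). It
  -- then merges with the neighbours' terms, as out(v) + s ≤ A(v).
  · have h1 : 1 ≤ K / a := (one_le_div h0').2 hAK
    calc X * outInfluence G J β B v + s * (X * (K / a))
        ≤ X * outInfluence G J β B v * (K / a) + s * (X * (K / a)) := by
          have := le_mul_of_one_le_right (mul_nonneg hX hout) h1
          linarith
      _ = X * (K / a) * (outInfluence G J β B v + s) := by ring
      _ ≤ X * (K / a) * a := mul_le_mul_of_nonneg_left hle (mul_nonneg hX (by linarith))
      _ = X * K := by field_simp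

end Influence

end SpinGlass

namespace SpinGlass

/-! ### Spectral gap of the block dynamics. -/

section BlockDynamics

variable {V : Type*} [Fintype V] [DecidableEq V]

lemma eq_of_flip_invariant {f : (V → Spin) → ℝ} (h : ∀ v ρ, f (flip v ρ) = f ρ) (A : Finset V) :
    ∀ σ τ, τ ∈ fiber A σ → f τ = f σ := by
  induction A using Finset.induction_on with
  | empty =>
    intro σ τ hτ
    congr 1
    funext v
    exact mem_fiber.1 hτ v (by simp)
  | insert u A hu ih =>
    intro σ τ hτ
    have h' : ∀ v, v ∉ A → v ≠ u → τ v = σ v := fun v hv hvu =>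
      mem_fiber.1 hτ v (by simp [hv, hvu])
    by_cases hs : τ u = σ u
    · refine ih σ τ (mem_fiber.2 fun v hv => ?_)
      by_cases hvu : v = u
      · rw [hvu, hs]
      · exact h' v hv hvu
    · rw [← h u τ]
      refine ih σ _ (mem_fiber.2 fun v hv => ?_)
      by_cases hvu : v = u
      · subst hvu
        rw [flip_self]
        rcases Int.units_eq_one_or (τ v) with h1 | h1 <;>
        rcases Int.units_eq_one_or (σ v) with h2 | h2 <;> simp_all
      · rw [flip_of_ne hvu]
        exact h' v hv hvu

lemma exists_flip_ne {f : (V → Spin) → ℝ} (hf : ¬ ∃ c : ℝ, ∀ x, f x = c) :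
    ∃ v ρ, f (flip v ρ) ≠ f ρ := by
  by_contra! h
  exact hf ⟨f 1, fun σ => eq_of_flip_invariant h Finset.univ 1 σ (mem_fiber.2 (by simp))⟩

variable (G : SimpleGraph V) (J : Sym2 V → ℝ) (β : ℝ)

lemma condExp_gibbs (A : Finset V) (f : (V → Spin) → ℝ) (σ : V → Spin) :
    condExp (gibbs G J β) A f σ = condExp (gibbsWeight G J β) A f σ := by
  rw [← condExp_const_mul (W := gibbsWeight G J β) (inv_pos.2 (sum_gibbsWeight_pos G J β)).ne']
  congr 1
  funext τ
  rw [inv_mul_eq_div]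
  unfold gibbs
  congr 2
  congr!

lemma fieldWeight_zero (W : (V → Spin) → ℝ) : fieldWeight W 0 = W := by
  funext τ; simp [fieldWeight]

lemma blockDynamics_mulVec [Fintype (V → Spin)] (blocks : Finset (Finset V))
    (f : (V → Spin) → ℝ) (σ : V → Spin) :
    (blockDynamics (gibbs G J β) blocks).mulVec f σ =
      (blocks.card : ℝ)⁻¹ * ∑ B ∈ blocks, condExp (gibbsWeight G J β) B f σ := by
  have : ∀ B ∈ blocks, condExp (gibbsWeight G J β) B f σ =
      ∑ τ, updateKernel (gibbs G J β) B σ τ * f τ := fun B _ => by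
    rw [← condExp_gibbs, ← sum_updateKernel_mul]
    congr!
  rw [Finset.sum_congr rfl this, Finset.sum_comm, Finset.mul_sum]
  unfold Matrix.mulVec dotProduct blockDynamics
  refine Finset.sum_congr rfl fun τ _ => ?_
  rw [mul_assoc, Finset.sum_mul]

open Classical in
lemma sum_parts_le (P : Finpartition (Finset.univ : Finset V)) (w : V) (g : V → ℝ) :
    ∑ B ∈ P.parts.erase (P.part w), ∑ u ∈ B.filter (fun u => G.Adj w u), g u =
      ∑ u : V with G.Adj w u ∧ u ∉ P.part w, g u := by
  rw [← Finset.sum_biUnion]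
  · refine Finset.sum_congr ?_ fun _ _ => rfl
    ext u
    simp only [Finset.mem_biUnion, Finset.mem_erase, Finset.mem_filter, Finset.mem_univ, true_and]
    constructor
    · rintro ⟨B, ⟨h1, h2⟩, h3, h4⟩
      refine ⟨h4, fun h5 => h1 ?_⟩
      exact P.eq_of_mem_parts h2 (P.part_mem.2 (Finset.mem_univ w)) h3 h5
    · rintro ⟨h1, h2⟩
      refine ⟨P.part u, ⟨fun h => h2 ?_, P.part_mem.2 (Finset.mem_univ u)⟩,
        P.mem_part (Finset.mem_univ u), h1⟩
      rw [← h]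
      exact P.mem_part (Finset.mem_univ u)
  · intro B hB B' hB' hne
    have := P.disjoint (Finset.mem_of_mem_erase hB) (Finset.mem_of_mem_erase hB') hne
    exact Finset.disjoint_filter_filter this

open Classical in
/-- One step of the block dynamics contracts the oscillations of an eigenfunction. -/
lemma eigenvalue_mul_oscillation_le (P : Finpartition (Finset.univ : Finset V))
    {f : (V → Spin) → ℝ} {l : ℝ}
    (hf : ∀ σ, (P.parts.card : ℝ)⁻¹ * ∑ B ∈ P.parts, condExp (gibbsWeight G J β) B f σ = l * f σ)
    (Δ : V → ℝ) (hΔ : ∀ v ρ, |f (flip v ρ) - f ρ| ≤ Δ v) (hΔ' : ∀ v, ∃ ρ, |f (flip v ρ) - f ρ| = Δ v)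
    (b : V → ℝ)
    (hb : ∀ B ∈ P.parts, ∀ u ∈ B, (∃ w, w ∉ B ∧ G.Adj u w) → ∀ h ρ,
      |condExp (fieldWeight (gibbsWeight G J β) h) (B.erase u) f (flip u ρ) -
        condExp (fieldWeight (gibbsWeight G J β) h) (B.erase u) f ρ| ≤ b u) (w : V) :
    |l| * Δ w ≤ (P.parts.card : ℝ)⁻¹ * ((P.parts.card - 1) * Δ w +
      ∑ u : V with G.Adj w u ∧ u ∉ P.part w, edgeInfluence J β s(w, u) * b u) := by
  obtain ⟨ρ, hρ⟩ := hΔ' w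
  have hpart := P.part_mem.2 (Finset.mem_univ w)
  have hcard : 1 ≤ P.parts.card := Finset.card_pos.2 ⟨_, hpart⟩
  have key : ∀ B ∈ P.parts.erase (P.part w),
      |condExp (gibbsWeight G J β) B f (flip w ρ) - condExp (gibbsWeight G J β) B f ρ| ≤
        Δ w + ∑ u ∈ B.filter (fun u => G.Adj w u), edgeInfluence J β s(w, u) * b u := by
    intro B hB
    have hBp := Finset.mem_of_mem_erase hB
    have hwB : w ∉ B := fun h =>
      (Finset.ne_of_mem_erase hB) (P.eq_of_mem_parts hBp hpart h (P.mem_part (Finset.mem_univ w)))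
    have := abs_condExp_flip_sub_le G J β hwB f (hΔ w) b
      (fun u hu hwu => hb B hBp u hu ⟨w, hwB, hwu.symm⟩) 0 ρ
    rwa [fieldWeight_zero] at this
  rw [← hρ, ← abs_mul, mul_sub, ← hf, ← hf, ← mul_sub, ← Finset.sum_sub_distrib, abs_mul,
    abs_of_nonneg (by positivity : (0 : ℝ) ≤ (P.parts.card : ℝ)⁻¹)]
  refine mul_le_mul_of_nonneg_left ?_ (by positivity)
  rw [← Finset.add_sum_erase _ _ hpart]
  -- The block of `w` resamples `w`, so its update does not see the flip; this term is the source of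
  -- the gap.
  rw [condExp_congr (flip_mem_fiber (P.mem_part (Finset.mem_univ w)) ρ), sub_self, zero_add]
  refine (Finset.abs_sum_le_sum_abs _ _).trans ((Finset.sum_le_sum key).trans (le_of_eq ?_))
  rw [Finset.sum_add_distrib, sum_parts_le G P w (fun u => edgeInfluence J β s(w, u) * b u),
    Finset.sum_const, Finset.card_erase_of_mem hpart, nsmul_eq_mul, Nat.cast_sub hcard, hρ]
  simp

/-- A spectral gap for the block dynamics, if the aggregate influences along every path that
enters a block multiply to at most `κ`. -/
theorem secondEigenvalue_blockDynamics_le (P : Finpartition (Finset.univ : Finset V))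
    (hpos : ∀ u w, G.Adj u w → 0 < edgeInfluence J β s(u, w)) {κ : ℝ} (hκ0 : 0 ≤ κ)
    (hN : 0 < P.parts.card)
    (hκ : ∀ B ∈ P.parts, ∀ v ∈ B, (∃ w, w ∉ B ∧ G.Adj v w) → ∀ (x : V) (p : G.Walk v x), p.IsPath →
      (∀ y ∈ p.support, y ∈ B) → (p.support.map (aggregateInfluence G J β)).prod ≤ κ) :
    secondEigenvalue (blockDynamics (gibbs G J β) P.parts) ≤ 1 - (1 - κ) / P.parts.card := by
  classical
  have hN' : (1 : ℝ) ≤ P.parts.card := by exact_mod_cast hN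
  have hN0 : (0 : ℝ) < P.parts.card := by linarith
  have hbound : 0 ≤ 1 - (1 - κ) / P.parts.card := by
    rw [sub_nonneg, div_le_one hN0]; linarith
  refine Real.sSup_le ?_ hbound
  rintro r ⟨l, f, hconst, heig, rfl⟩
  have hf : ∀ σ, (P.parts.card : ℝ)⁻¹ * ∑ B ∈ P.parts, condExp (gibbsWeight G J β) B f σ =
      l * f σ := by
    intro σ
    have := congrFun heig σ
    rwa [blockDynamics_mulVec] at this
  by_contra! hl
  set Δ : V → ℝ := fun v => Finset.univ.sup' Finset.univ_nonempty fun ρ => |f (flip v ρ) - f ρ|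
  have hΔ : ∀ v ρ, |f (flip v ρ) - f ρ| ≤ Δ v := fun v ρ =>
    Finset.le_sup' (fun ρ => |f (flip v ρ) - f ρ|) (Finset.mem_univ ρ)
  have hΔ' : ∀ v, ∃ ρ, |f (flip v ρ) - f ρ| = Δ v := fun v => by
    obtain ⟨ρ, -, h⟩ := Finset.exists_mem_eq_sup' Finset.univ_nonempty
      (fun ρ => |f (flip v ρ) - f ρ|)
    exact ⟨ρ, h.symm⟩
  have hΔ0 : ∀ v, 0 ≤ Δ v := fun v => (abs_nonneg _).trans (hΔ v 1)
  -- A vertex acts on other blocks only through edges leaving its own block, so oscillations are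
  -- measured relative to φ.
  set φ : V → ℝ := fun w => outInfluence G J β (P.part w) w
  have hφ0 : ∀ w, 0 ≤ φ w := fun w => outInfluence_nonneg G J β _ w
  have hinv : (P.parts.card : ℝ)⁻¹ * (P.parts.card - 1) = 1 - (P.parts.card : ℝ)⁻¹ := by
    field_simp
  have hinvpos : 0 < (P.parts.card : ℝ)⁻¹ := by positivity
  rw [div_eq_mul_inv] at hl
  -- Without outgoing influence even the crude bound 2M on `b` gives |l|Δ(w) ≤ (1-1/N)Δ(w). As |l| >
  -- 1-(1-κ)/N ≥ 1-1/N, this forces Δ(w) = 0.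
  have hzero : ∀ w, φ w = 0 → Δ w = 0 := by
    intro w hw
    obtain ⟨M, hM⟩ : ∃ M, ∀ σ, |f σ| ≤ M :=
      ⟨∑ σ, |f σ|, fun σ => Finset.single_le_sum (fun σ _ => abs_nonneg (f σ)) (Finset.mem_univ σ)⟩
    have hcM : ∀ h (A : Finset V) ρ, |condExp (fieldWeight (gibbsWeight G J β) h) A f ρ| ≤ M := by
      intro h A ρ
      have := condExp_abs_sub_le (fieldWeight_pos (gibbsWeight_pos G J β) h) A (f := f)
        (g := fun _ => 0) ρ (D := M) (by simpa using hM)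
      simpa [condExp] using this
    have := eigenvalue_mul_oscillation_le G J β P hf Δ hΔ hΔ' (fun _ => M + M)
      (fun B _ u _ _ h ρ => (abs_sub _ _).trans (add_le_add (hcM _ _ _) (hcM _ _ _))) w
    have hsum : ∑ u : V with G.Adj w u ∧ u ∉ P.part w, edgeInfluence J β s(w, u) * (M + M) = 0 := by
      rw [← Finset.sum_mul]
      exact mul_eq_zero_of_left hw _
    rw [hsum, add_zero, ← mul_assoc, hinv] at this
    by_contra hne
    have hlt : 0 < Δ w := lt_of_le_of_ne (hΔ0 w) (Ne.symm hne)
    have := le_of_mul_le_mul_right this hlt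
    nlinarith
  obtain ⟨v₀, ρ₀, hne⟩ := exists_flip_ne hconst
  -- Quotients with φ = 0 count as 0, harmlessly: `hzero` gives Δ = 0 there.
  obtain ⟨w, -, hw⟩ := Finset.exists_max_image Finset.univ (fun w => Δ w / φ w)
    ⟨v₀, Finset.mem_univ v₀⟩
  set X := Δ w / φ w
  have hX : ∀ u, Δ u ≤ X * φ u := by
    intro u
    rcases (hφ0 u).eq_or_lt with h | h
    · rw [hzero u h.symm, ← h, mul_zero]
    · exact (div_le_iff₀ h).1 (hw u (Finset.mem_univ u))
  have hX0 : 0 < X := by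
    have h1 : 0 < Δ v₀ := (abs_pos.2 (sub_ne_zero.2 hne)).trans_le (hΔ v₀ ρ₀)
    by_contra! h
    exact absurd (h1.trans_le (hX v₀)) (not_lt.2 (mul_nonpos_of_nonpos_of_nonneg h (hφ0 v₀)))
  have hφw : φ w ≠ 0 := by
    intro h
    simp [X, h] at hX0
  have hΔw : Δ w = X * φ w := (div_mul_cancel₀ _ hφw).symm
  have hφw' : 0 < φ w := lt_of_le_of_ne (hφ0 w) (Ne.symm hφw)
  have := eigenvalue_mul_oscillation_le G J β P hf Δ hΔ hΔ' (fun _ => X * κ) (by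
    intro B hB u hu hw' h ρ
    refine abs_condExp_flip_sub_le_of_paths G J β hpos f hX0.le (B := B) ?_ (B.erase u) u κ
      (Finset.erase_subset _ _) hu (Finset.notMem_erase _ _) ?_ h ρ
    · intro x hx ρ
      have : P.part x = B := P.part_eq_of_mem hB hx
      have h2 := hX x
      simp only [φ, this] at h2
      exact (hΔ x ρ).trans h2
    · intro x p hp hpB
      rw [Finset.insert_erase hu] at hpB
      exact hκ B hB u hu hw' x p hp hpB) w
  rw [← Finset.sum_mul] at this
  change _ ≤ _ * (_ + φ w * (X * κ)) at this
  have e : (P.parts.card : ℝ)⁻¹ * ((P.parts.card - 1) * Δ w + φ w * (X * κ)) =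
      (1 - (1 - κ) * (P.parts.card : ℝ)⁻¹) * Δ w := by
    rw [mul_add, ← mul_assoc, hinv, hΔw]; ring
  rw [e] at this
  have := le_of_mul_le_mul_right this (hΔw ▸ mul_pos hX0 hφw')
  linarith

end BlockDynamics

end SpinGlass

namespace SpinGlass

/-! ### Contraction along paths that enter a block. -/

lemma prod_map_le_prod_map_of_nonneg {α : Type*} {a b : α → ℝ} (ha : ∀ x, 0 ≤ a x)
    (hab : ∀ x, a x ≤ b x) (l : List α) : (l.map a).prod ≤ (l.map b).prod := by
  induction l with
  | nil => simp
  | cons x l ih =>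
    simp only [List.map_cons, List.prod_cons]
    exact mul_le_mul (hab x) ih (List.prod_nonneg (by simpa using fun y _ => ha y))
      ((ha x).trans (hab x))

section BlockVertices

variable {V : Type*} [Fintype V] [DecidableEq V] (G : SimpleGraph V) (J : Sym2 V → ℝ) (β : ℝ)

/-- The contraction constant of the block dynamics. -/
noncomputable def contraction (ε : ℝ) : ℝ := (1 - ε / 2) / (1 - ε / 4) ^ 2

lemma contraction_nonneg {ε : ℝ} (h1 : ε < 1) : 0 ≤ contraction ε :=
  div_nonneg (by linarith) (sq_nonneg _)

/-- (1-ε/4)² exceeds 1-ε/2 by ε²/16. -/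
lemma contraction_lt_one {ε : ℝ} (h0 : 0 < ε) (h1 : ε < 1) : contraction ε < 1 := by
  unfold contraction
  rw [div_lt_one (by nlinarith)]
  nlinarith [mul_pos h0 h0]

lemma le_contraction {ε : ℝ} (h0 : 0 < ε) (h1 : ε < 1) : 1 - ε / 2 ≤ contraction ε := by
  unfold contraction
  refine le_div_self (by linarith) (by nlinarith) ?_
  nlinarith

variable {G J β}

lemma vertexWeight_ge {d ε : ℝ} (hd : 2 ≤ d) (h0 : 0 < ε) (h1 : ε < 1) (u : V) :
    1 - ε / 4 ≤ vertexWeight G J β d ε u := by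
  unfold vertexWeight
  split_ifs with h
  · exact le_rfl
  · nlinarith [not_le.1 h]

/-- For light vertices the gain is the gap between the threshold 1-ε/2 and the weight 1-ε/4. For
heavy ones it comes from (1-ε/2)d ≥ 1. -/
lemma aggregateInfluence_le_vertexWeight {d ε : ℝ} (hd : 2 ≤ d) (h0 : 0 < ε) (h1 : ε < 1)
    (u : V) : aggregateInfluence G J β u ≤
      (1 - ε / 2) / (1 - ε / 4) * vertexWeight G J β d ε u := by
  have h4 : 0 < 1 - ε / 4 := by linarith
  unfold vertexWeight
  split_ifs with h
  · rwa [div_mul_cancel₀ _ h4.ne']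
  · have hA := aggregateInfluence_nonneg G J β u
    rw [div_mul_eq_mul_div, le_div_iff₀ h4]
    have : 1 ≤ (1 - ε / 2) * d := by nlinarith
    nlinarith

/-- The trivial path already shows M(u) < 1, whereas a heavy vertex has M(u) > 2(1-ε/2) > 1. -/
lemma IsBlockVertex.aggregateInfluence_le {d ε : ℝ} (hd : 2 ≤ d) (h1 : ε < 1) {u : V}
    (h : IsBlockVertex G J β d ε u) : aggregateInfluence G J β u ≤ 1 - ε / 2 := by
  have := h u SimpleGraph.Walk.nil (by simp) (by simpa using Real.log_natCast_nonneg _)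
  simp only [pathWeight, SimpleGraph.Walk.support_nil, List.map_cons, List.map_nil,
    List.prod_cons, List.prod_nil, mul_one] at this
  unfold vertexWeight at this
  split_ifs at this with h'
  · exact h'
  · nlinarith [not_le.1 h']

/-- The aggregate influences along a path entering a block contract. -/
lemma prod_aggregateInfluence_le {d ε : ℝ} (hd : 2 ≤ d) (h0 : 0 < ε) (h1 : ε < 1) {B : Finset V}
    (hB : IsGoodBlock G J β d ε B)
    (hlen : 1 < B.card → ∀ (v x : V) (p : G.Walk v x), p.IsPath → (∀ y ∈ p.support, y ∈ B) →
      (p.length : ℝ) + 1 ≤ Real.log (Fintype.card V))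
    {v : V} (hv : v ∈ B) (hw : ∃ w, w ∉ B ∧ G.Adj v w) {x : V} (p : G.Walk v x) (hp : p.IsPath)
    (hpB : ∀ y ∈ p.support, y ∈ B) :
    (p.support.map (aggregateInfluence G J β)).prod ≤ contraction ε := by
  rcases (Nat.one_le_iff_ne_zero.2 (Finset.card_ne_zero_of_mem hv)).eq_or_lt with hc | hc
  · obtain ⟨b, rfl⟩ := Finset.card_eq_one.1 hc.symm
    have hbl := (hB.single hc.symm v hv).aggregateInfluence_le hd h1
    cases p with
    | nil => simpa using hbl.trans (le_contraction h0 h1)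
    | @cons _ u _ h q =>
      exfalso
      have h3 := hpB u (by simp)
      rw [Finset.mem_singleton] at h3 hv
      exact h.ne (hv.trans h3.symm)
  · obtain ⟨w, hwB, hvw⟩ := hw
    have hblock := hB.boundary_block hc w ⟨hwB, v, hv, hvw.symm⟩
    -- Stepping in from the block vertex `w` lengthens the path by one; hence the +1 in `hlen`.
    have hpath : (SimpleGraph.Walk.cons hvw.symm p).IsPath :=
      SimpleGraph.Walk.IsPath.cons hp fun hmem => hwB (hpB w hmem)
    have hlt := hblock x _ hpath (by
      simpa using hlen hc v x p hp hpB)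
    have hM : ∀ u, 0 < vertexWeight G J β d ε u := fun u =>
      lt_of_lt_of_le (by linarith) (vertexWeight_ge hd h0 h1 u)
    have h4 : 0 < 1 - ε / 4 := by linarith
    have hθ1 : (1 - ε / 2) / (1 - ε / 4) ≤ 1 := by rw [div_le_one h4]; linarith
    have hθ0 : 0 ≤ (1 - ε / 2) / (1 - ε / 4) := div_nonneg (by linarith) h4.le
    have hA := fun u => aggregateInfluence_le_vertexWeight (G := G) (J := J) (β := β) hd h0 h1 u
    have hAM : ∀ u, aggregateInfluence G J β u ≤ vertexWeight G J β d ε u := fun u =>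
      (hA u).trans (mul_le_of_le_one_left (hM u).le hθ1)
    rw [pathWeight, SimpleGraph.Walk.support_cons, List.map_cons, List.prod_cons] at hlt
    -- The gain is taken at the first vertex only; elsewhere A ≤ M is enough.
    have hprod : (p.support.map (aggregateInfluence G J β)).prod ≤
        (1 - ε / 2) / (1 - ε / 4) * (p.support.map (vertexWeight G J β d ε)).prod := by
      rw [← SimpleGraph.Walk.cons_tail_support p, List.map_cons, List.map_cons, List.prod_cons,
        List.prod_cons, ← mul_assoc]
      refine mul_le_mul (hA v) (prod_map_le_prod_map_of_nonneg (aggregateInfluence_nonneg G J β)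
        hAM _) (List.prod_nonneg fun a ha => ?_)
        (mul_nonneg hθ0 (hM v).le)
      obtain ⟨y, -, rfl⟩ := List.mem_map.1 ha
      exact aggregateInfluence_nonneg G J β y
    -- The weight of `w` is at least 1-ε/4, so removing it from a product below 1 leaves at most
    -- 1/(1-ε/4).
    have hMp : (p.support.map (vertexWeight G J β d ε)).prod ≤ 1 / (1 - ε / 4) := by
      rw [le_div_iff₀ h4]
      have hnn : 0 ≤ (p.support.map (vertexWeight G J β d ε)).prod :=
        List.prod_nonneg (by simpa using fun y _ => (hM y).le)
      have := mul_le_mul_of_nonneg_right (vertexWeight_ge (G := G) (J := J) (β := β) hd h0 h1 w) hnn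
      linarith
    refine hprod.trans ((mul_le_mul_of_nonneg_left hMp hθ0).trans (le_of_eq ?_))
    unfold contraction
    field_simp

end BlockVertices

end SpinGlass

namespace SpinGlass

/-! ### Variance, independence and Poincaré inequalities. -/

section Poincare

variable {S : Type*} [Fintype S] [DecidableEq S] {W : (S → Spin) → ℝ}

/-- Each ρ is reached from exactly the τ in its own B-fiber, and their normalised weights sum to
one. -/
lemma sum_fiber_swap (hW : ∀ σ, 0 < W σ) {A B : Finset S} (hBA : B ⊆ A) (σ : S → Spin)
    (h : (S → Spin) → ℝ) :
    ∑ τ ∈ fiber A σ, W τ / fiberMass W B τ * ∑ ρ ∈ fiber B τ, h ρ = ∑ ρ ∈ fiber A σ, h ρ := by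
  simp only [Finset.mul_sum]
  rw [Finset.sum_comm' (t' := fiber A σ) (s' := fun ρ => fiber B ρ)]
  · refine Finset.sum_congr rfl fun ρ _ => ?_
    have : ∀ τ ∈ fiber B ρ, W τ / fiberMass W B τ * h ρ = W τ / fiberMass W B ρ * h ρ :=
      fun τ hτ => by rw [fiberMass_congr hτ]
    rw [Finset.sum_congr rfl this, ← Finset.sum_mul, ← Finset.sum_div]
    change fiberMass W B ρ / fiberMass W B ρ * h ρ = h ρ
    rw [div_self (fiberMass_pos hW B ρ).ne', one_mul]
  · intro τ ρ
    constructor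
    · rintro ⟨h1, h2⟩
      refine ⟨mem_fiber_comm.1 h2, ?_⟩
      rw [← fiber_eq_of_mem h1]
      exact fiber_mono hBA τ h2
    · rintro ⟨h1, h2⟩
      refine ⟨?_, mem_fiber_comm.1 h1⟩
      rw [← fiber_eq_of_mem h2]
      exact fiber_mono hBA ρ h1

/-- Conditional expectation is the orthogonal projection onto the functions constant on B-fibers;
Pythagoras and minimality of the residual follow. -/
lemma sum_sub_condExp_mul (hW : ∀ σ, 0 < W σ) {A B : Finset S} (hBA : B ⊆ A)
    (f g : (S → Spin) → ℝ) (hg : ∀ τ, ∀ ρ ∈ fiber B τ, g ρ = g τ) (σ : S → Spin) :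
    ∑ τ ∈ fiber A σ, W τ * (f τ - condExp W B f τ) * g τ = 0 := by
  have h1 : ∑ τ ∈ fiber A σ, W τ * condExp W B f τ * g τ = ∑ τ ∈ fiber A σ, W τ * f τ * g τ := by
    rw [← sum_fiber_swap hW hBA σ fun τ => W τ * f τ * g τ]
    refine Finset.sum_congr rfl fun τ _ => ?_
    have : ∑ ρ ∈ fiber B τ, W ρ * f ρ * g ρ = (∑ ρ ∈ fiber B τ, W ρ * f ρ) * g τ := by
      rw [Finset.sum_mul]
      exact Finset.sum_congr rfl fun ρ hρ => by rw [hg τ ρ hρ]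
    rw [this]
    unfold condExp
    ring
  simp only [mul_sub, sub_mul, Finset.sum_sub_distrib]
  rw [h1, sub_self]

/-- The weighted square distance, over the `A`-fiber of `σ`, of `f` to its conditional
expectation given the configuration off `B`. -/
noncomputable def residual (W : (S → Spin) → ℝ) (A B : Finset S) (f : (S → Spin) → ℝ)
    (σ : S → Spin) : ℝ :=
  ∑ τ ∈ fiber A σ, W τ * (f τ - condExp W B f τ) ^ 2

lemma residual_nonneg (hW : ∀ σ, 0 < W σ) (A B : Finset S) (f : (S → Spin) → ℝ) (σ : S → Spin) :
    0 ≤ residual W A B f σ :=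
  Finset.sum_nonneg fun τ _ => mul_nonneg (hW τ).le (sq_nonneg _)

lemma sum_sub_sq_eq_residual_add (hW : ∀ σ, 0 < W σ) {A B : Finset S} (hBA : B ⊆ A)
    (f g : (S → Spin) → ℝ) (hg : ∀ τ, ∀ ρ ∈ fiber B τ, g ρ = g τ) (σ : S → Spin) :
    ∑ τ ∈ fiber A σ, W τ * (f τ - g τ) ^ 2 =
      residual W A B f σ + ∑ τ ∈ fiber A σ, W τ * (condExp W B f τ - g τ) ^ 2 := by
  have h := sum_sub_condExp_mul hW hBA f (fun τ => condExp W B f τ - g τ)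
    (fun τ ρ hρ => by rw [condExp_congr hρ, hg τ ρ hρ]) σ
  unfold residual
  rw [← Finset.sum_add_distrib, ← sub_eq_zero, ← Finset.sum_sub_distrib]
  refine Eq.trans (Finset.sum_congr rfl fun τ _ => ?_) (mul_eq_zero_of_right (2 : ℝ) h |>.symm ▸
    (Finset.mul_sum (fiber A σ) _ (2 : ℝ)).symm)
  ring

lemma residual_le_sum (hW : ∀ σ, 0 < W σ) {A B : Finset S} (hBA : B ⊆ A)
    (f g : (S → Spin) → ℝ) (hg : ∀ τ, ∀ ρ ∈ fiber B τ, g ρ = g τ) (σ : S → Spin) :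
    residual W A B f σ ≤ ∑ τ ∈ fiber A σ, W τ * (f τ - g τ) ^ 2 := by
  rw [sum_sub_sq_eq_residual_add hW hBA f g hg]
  exact le_add_of_nonneg_right (Finset.sum_nonneg fun τ _ => mul_nonneg (hW τ).le (sq_nonneg _))

/-- The projection for W' is a competitor in the minimisation for W, so only the density bound
enters and the conditional means need not be compared. -/
lemma residual_mono {W' : (S → Spin) → ℝ} (hW : ∀ σ, 0 < W σ) {b : ℝ}
    (h : ∀ σ, W σ ≤ b * W' σ) {A B : Finset S} (hBA : B ⊆ A) (f : (S → Spin) → ℝ)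
    (σ : S → Spin) : residual W A B f σ ≤ b * residual W' A B f σ := by
  refine (residual_le_sum hW hBA f (condExp W' B f) (fun τ ρ hρ => condExp_congr hρ) σ).trans ?_
  unfold residual
  rw [Finset.mul_sum]
  refine Finset.sum_le_sum fun τ _ => ?_
  rw [← mul_assoc]
  exact mul_le_mul_of_nonneg_right (h τ) (sq_nonneg _)

lemma sum_div_mul_residual (hW : ∀ σ, 0 < W σ) {A B : Finset S} (hBA : B ⊆ A) (C : Finset S)
    (f : (S → Spin) → ℝ) (σ : S → Spin) :
    ∑ τ ∈ fiber A σ, W τ / fiberMass W B τ * residual W B C f τ = residual W A C f σ :=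
  sum_fiber_swap hW hBA σ _

/-- Under `W`, the configurations on `A₁` and `A₂` are independent given the rest. -/
def IsIndep (W : (S → Spin) → ℝ) (A₁ A₂ : Finset S) : Prop :=
  ∀ σ τ₁ τ₂ ρ, τ₁ ∈ fiber A₁ σ → τ₂ ∈ fiber A₂ σ → ρ ∈ fiber A₂ τ₁ → ρ ∈ fiber A₁ τ₂ →
    W σ * W ρ = W τ₁ * W τ₂

lemma sum_fiber_union {A₁ A₂ : Finset S} (hd : Disjoint A₁ A₂) (σ : S → Spin)
    (g : (S → Spin) → ℝ) :
    ∑ τ ∈ fiber (A₁ ∪ A₂) σ, g τ = ∑ τ ∈ fiber A₁ σ, ∑ ρ ∈ fiber A₂ τ, g ρ := by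
  have hmaps : ∀ τ ∈ fiber (A₁ ∪ A₂) σ, A₁.piecewise τ σ ∈ fiber A₁ σ := fun τ _ =>
    mem_fiber.2 fun v hv => by simp [hv]
  rw [← Finset.sum_fiberwise_of_maps_to hmaps]
  refine Finset.sum_congr rfl fun τ hτ => Finset.sum_congr ?_ fun _ _ => rfl
  rw [mem_fiber] at hτ
  ext ρ
  simp only [Finset.mem_filter, mem_fiber, Finset.mem_union, not_or]
  constructor
  · rintro ⟨h1, rfl⟩ v hv
    by_cases h : v ∈ A₁
    · simp [h]
    · simp [h, h1 v ⟨h, hv⟩]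
  · intro h
    refine ⟨fun v hv => (h v hv.2).trans (hτ v hv.1), ?_⟩
    funext v
    by_cases hv : v ∈ A₁
    · simp [hv, h v (Finset.disjoint_left.1 hd hv)]
    · simp [hv, hτ v hv]

lemma IsIndep.mul_fiberMass {A₁ A₂ : Finset S} (hI : IsIndep W A₁ A₂)
    {σ τ : S → Spin} (hτ : τ ∈ fiber A₁ σ) :
    W σ * fiberMass W A₂ τ = W τ * fiberMass W A₂ σ := by
  unfold fiberMass
  rw [Finset.mul_sum, Finset.mul_sum]
  have hτ' := mem_fiber.1 hτ
  refine Finset.sum_nbij' (fun ρ => A₂.piecewise ρ σ) (fun ρ => A₂.piecewise ρ τ) ?_ ?_ ?_ ?_ ?_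
  · intro ρ _
    exact mem_fiber.2 fun v hv => by simp [hv]
  · intro ρ _
    exact mem_fiber.2 fun v hv => by simp [hv]
  · intro ρ hρ
    funext v
    by_cases hv : v ∈ A₂
    · simp [hv]
    · simp [hv, mem_fiber.1 hρ v hv]
  · intro ρ hρ
    funext v
    by_cases hv : v ∈ A₂
    · simp [hv]
    · simp [hv, mem_fiber.1 hρ v hv]
  · intro ρ hρ
    refine hI σ τ _ ρ hτ (mem_fiber.2 fun v hv => by simp [hv]) hρ (mem_fiber.2 fun v hv => ?_)
    by_cases hv' : v ∈ A₂
    · simp [hv']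
    · simp [hv', mem_fiber.1 hρ v hv', hτ' v hv]

lemma IsIndep.condExp_condExp (hW : ∀ σ, 0 < W σ) {A₁ A₂ : Finset S} (hd : Disjoint A₁ A₂)
    (hI : IsIndep W A₁ A₂) (f : (S → Spin) → ℝ) (σ : S → Spin) :
    condExp W A₁ (condExp W A₂ f) σ = condExp W (A₁ ∪ A₂) f σ := by
  have h1 : fiberMass W (A₁ ∪ A₂) σ = fiberMass W A₁ σ * fiberMass W A₂ σ / W σ := by
    unfold fiberMass
    rw [sum_fiber_union hd, eq_div_iff (hW σ).ne', Finset.sum_mul, Finset.sum_mul]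
    refine Finset.sum_congr rfl fun τ hτ => ?_
    rw [mul_comm]
    exact hI.mul_fiberMass hτ
  have h2 : ∀ τ ∈ fiber A₁ σ, W τ * condExp W A₂ f τ =
      W σ / fiberMass W A₂ σ * ∑ ρ ∈ fiber A₂ τ, W ρ * f ρ := by
    intro τ hτ
    unfold condExp
    have h3 := hI.mul_fiberMass hτ
    have := (fiberMass_pos hW A₂ σ).ne'
    have := (fiberMass_pos hW A₂ τ).ne'
    field_simp
    linear_combination (-(∑ x ∈ fiber A₂ τ, W x * f x)) * h3
  have h4 : condExp W A₁ (condExp W A₂ f) σ =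
      (∑ τ ∈ fiber A₁ σ, W τ * condExp W A₂ f τ) / fiberMass W A₁ σ := rfl
  rw [h4, Finset.sum_congr rfl h2, ← Finset.mul_sum, ← sum_fiber_union hd σ fun ρ => W ρ * f ρ]
  unfold condExp
  rw [h1]
  have := (fiberMass_pos hW A₂ σ).ne'
  have := (fiberMass_pos hW A₁ σ).ne'
  have := (hW σ).ne'
  field_simp

lemma condExp_sub (W : (S → Spin) → ℝ) (A : Finset S) (f g : (S → Spin) → ℝ) (σ : S → Spin) :
    condExp W A (fun τ => f τ - g τ) σ = condExp W A f σ - condExp W A g σ := by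
  unfold condExp
  rw [← sub_div, ← Finset.sum_sub_distrib]
  simp only [mul_sub]

lemma sum_condExp_sq_le (hW : ∀ σ, 0 < W σ) {A B : Finset S} (hBA : B ⊆ A)
    (g : (S → Spin) → ℝ) (σ : S → Spin) :
    ∑ τ ∈ fiber A σ, W τ * condExp W B g τ ^ 2 ≤ ∑ τ ∈ fiber A σ, W τ * g τ ^ 2 := by
  have := sum_sub_sq_eq_residual_add hW hBA g (fun _ => 0) (fun _ _ _ => rfl) σ
  simp only [sub_zero] at this
  rw [this]
  exact le_add_of_nonneg_left (residual_nonneg hW _ _ _ _)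

/-- With E_i the averaging over A_i, independence makes E₁E₂ the averaging over the union. Thus f -
E₁E₂f = (f - E₁f) + E₁(f - E₂f) is an orthogonal sum, and E₁ is a contraction. -/
lemma IsIndep.residual_union_le (hW : ∀ σ, 0 < W σ) {A₁ A₂ : Finset S} (hd : Disjoint A₁ A₂)
    (hI : IsIndep W A₁ A₂) (f : (S → Spin) → ℝ) (σ : S → Spin) :
    residual W (A₁ ∪ A₂) (A₁ ∪ A₂) f σ ≤
      residual W (A₁ ∪ A₂) A₁ f σ + residual W (A₁ ∪ A₂) A₂ f σ := by
  have h1 := sum_sub_sq_eq_residual_add hW (A := A₁ ∪ A₂) Finset.subset_union_left f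
    (condExp W (A₁ ∪ A₂) f)
    (fun τ ρ hρ => condExp_congr (fiber_mono Finset.subset_union_left τ hρ)) σ
  have h2 := sum_condExp_sq_le hW (A := A₁ ∪ A₂) (B := A₁) Finset.subset_union_left
    (fun τ => f τ - condExp W A₂ f τ) σ
  have h3 : ∀ τ, condExp W A₁ (fun τ => f τ - condExp W A₂ f τ) τ =
      condExp W A₁ f τ - condExp W (A₁ ∪ A₂) f τ := fun τ => by
    rw [condExp_sub, hI.condExp_condExp hW hd]
  simp only [h3] at h2
  change residual W (A₁ ∪ A₂) (A₁ ∪ A₂) f σ = _ at h1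
  rw [h1]
  exact add_le_add le_rfl h2

/-- The Poincaré inequality for the single-site dynamics on `A`, uniformly in the configuration
off `A`. -/
def IsPoincare (W : (S → Spin) → ℝ) (A : Finset S) (T : ℝ) : Prop :=
  ∀ f σ, residual W A A f σ ≤ T * ∑ u ∈ A, residual W A {u} f σ

lemma IsPoincare.mono (hW : ∀ σ, 0 < W σ) {A : Finset S} {T T' : ℝ} (h : IsPoincare W A T)
    (hT : T ≤ T') : IsPoincare W A T' := fun f σ =>
  (h f σ).trans (mul_le_mul_of_nonneg_right hT (Finset.sum_nonneg fun _ _ =>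
    residual_nonneg hW _ _ _ _))

/-- Holley–Stroock comparison: `b` pays for the variance, `a` for the Dirichlet form. -/
lemma IsPoincare.compare {W' : (S → Spin) → ℝ} (hW : ∀ σ, 0 < W σ) (hW' : ∀ σ, 0 < W' σ)
    {a b T : ℝ} (hb0 : 0 ≤ b) (hT : 0 ≤ T) (ha : ∀ σ, W' σ ≤ a * W σ) (hb : ∀ σ, W σ ≤ b * W' σ)
    {A : Finset S} (h : IsPoincare W' A T) : IsPoincare W A (b * a * T) := by
  intro f σ
  calc residual W A A f σ ≤ b * residual W' A A f σ := residual_mono hW hb subset_rfl f σ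
    _ ≤ b * (T * ∑ u ∈ A, residual W' A {u} f σ) := mul_le_mul_of_nonneg_left (h f σ) hb0
    _ ≤ b * (T * ∑ u ∈ A, a * residual W A {u} f σ) := by
        refine mul_le_mul_of_nonneg_left (mul_le_mul_of_nonneg_left ?_ hT) hb0
        exact Finset.sum_le_sum fun u hu =>
          residual_mono hW' ha (Finset.singleton_subset_iff.2 hu) f σ
    _ = b * a * T * ∑ u ∈ A, residual W A {u} f σ := by rw [← Finset.mul_sum]; ring

lemma isPoincare_singleton (W : (S → Spin) → ℝ) (u : S) : IsPoincare W {u} 1 := by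
  intro f σ; simp

lemma isPoincare_empty (hW : ∀ σ, 0 < W σ) (T : ℝ) : IsPoincare W ∅ T := by
  intro f σ
  have : ∀ σ : S → Spin, fiber ∅ σ = {σ} := fun σ => by
    ext τ; simp [mem_fiber, funext_iff]
  simp [residual, condExp, fiberMass, this, mul_div_cancel_left₀ _ (hW σ).ne']

/-- Tensorisation: each one-set residual is an average of local ones, to which the hypothesis
applies fiber by fiber. The constant does not grow. -/
lemma IsPoincare.union (hW : ∀ σ, 0 < W σ) {A₁ A₂ : Finset S} (hd : Disjoint A₁ A₂)
    (hI : IsIndep W A₁ A₂) {T : ℝ} (h₁ : IsPoincare W A₁ T) (h₂ : IsPoincare W A₂ T) :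
    IsPoincare W (A₁ ∪ A₂) T := by
  intro f σ
  have key : ∀ A ⊆ A₁ ∪ A₂, IsPoincare W A T → residual W (A₁ ∪ A₂) A f σ ≤
      T * ∑ u ∈ A, residual W (A₁ ∪ A₂) {u} f σ := by
    intro A hA h
    simp only [← sum_div_mul_residual hW hA _ f σ]
    rw [Finset.sum_comm, Finset.mul_sum]
    refine Finset.sum_le_sum fun τ _ => ?_
    rw [← Finset.mul_sum, mul_left_comm]
    exact mul_le_mul_of_nonneg_left (h f τ) (div_pos (hW τ) (fiberMass_pos hW A τ)).le
  rw [Finset.sum_union hd, mul_add]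
  exact (hI.residual_union_le hW hd f σ).trans (add_le_add (key _ Finset.subset_union_left h₁)
    (key _ Finset.subset_union_right h₂))

end Poincare

end SpinGlass

namespace SpinGlass

/-! ### Poincaré constants by eliminating vertices along paths. -/

section Elimination

variable {V : Type*} [Fintype V] [DecidableEq V] (J : Sym2 V → ℝ) (β : ℝ)

/-- Every edge misses A₁ or A₂, so its contributions to the two products agree, up to exchanging the
factors. -/
lemma isIndep_gibbsWeight (H : SimpleGraph V) {A₁ A₂ : Finset V} (hd : Disjoint A₁ A₂)
    (hadj : ∀ x ∈ A₁, ∀ y ∈ A₂, ¬ H.Adj x y) : IsIndep (gibbsWeight H J β) A₁ A₂ := by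
  classical
  intro σ τ₁ τ₂ ρ h1 h2 h3 h4
  rw [mem_fiber] at h1 h2 h3 h4
  unfold gibbsWeight
  rw [← Real.exp_add, ← Real.exp_add, ← mul_add, ← mul_add, ← Finset.sum_add_distrib,
    ← Finset.sum_add_distrib]
  congr 2
  refine Finset.sum_congr rfl fun e he => ?_
  induction e using Sym2.ind with
  | _ x y =>
  have hxy : H.Adj x y := by simpa using he
  have key : (x ∉ A₁ ∧ y ∉ A₁) ∨ (x ∉ A₂ ∧ y ∉ A₂) := by
    by_cases hx : x ∈ A₁
    · exact Or.inr ⟨Finset.disjoint_left.1 hd hx, fun hy => hadj x hx y hy hxy⟩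
    · by_cases hy : y ∈ A₁
      · exact Or.inr ⟨fun hx' => hadj y hy x hx' hxy.symm, Finset.disjoint_left.1 hd hy⟩
      · exact Or.inl ⟨hx, hy⟩
  rcases key with ⟨hx, hy⟩ | ⟨hx, hy⟩
  · simp only [Sym2.map_mk, h4 x hx, h4 y hy, h1 x hx, h1 y hy]
    congr!
  · simp only [Sym2.map_mk, h2 x hx, h2 y hy, h3 x hx, h3 y hy]
    rw [add_comm]
    congr!

open Classical in
/-- The total absolute coupling of the edges of `H` in `F`. -/
noncomputable def deletedWeight (H : SimpleGraph V) (F : Set (Sym2 V)) : ℝ :=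
  ∑ e ∈ H.edgeFinset with e ∈ F, |J e|

open Classical in
/-- Deleting edges changes the Poincaré constant by at most the exponential of their weight. -/
lemma IsPoincare.of_deleteEdges {β : ℝ} (hβ : 0 ≤ β) (H : SimpleGraph V) (F : Set (Sym2 V))
    {A : Finset V} {T : ℝ} (hT : 0 ≤ T) (h : IsPoincare (gibbsWeight (H.deleteEdges F) J β) A T) :
    IsPoincare (gibbsWeight H J β) A
      (Real.exp (β * deletedWeight J H F) * T) := by
  obtain ⟨H', hH'⟩ : ∃ H', H' = H.deleteEdges F := ⟨_, rfl⟩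
  rw [← hH'] at h
  have hsplit : ∀ σ : V → Spin, (∑ e ∈ H.edgeFinset, if (e.map σ).IsDiag then J e else 0) =
      (∑ e ∈ H'.edgeFinset, if (e.map σ).IsDiag then J e else 0) +
        ∑ e ∈ H.edgeFinset with e ∈ F, if (e.map σ).IsDiag then J e else 0 := by
    intro σ
    rw [← Finset.sum_filter_add_sum_filter_not H.edgeFinset (fun e => e ∈ F), add_comm]
    congr 1
    refine Finset.sum_congr ?_ fun _ _ => rfl
    ext e
    simp [hH']
  -- The positive parts bound the density ratio in one direction and the negative parts in the
  -- other, so each edge is paid once, as |J_e|.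
  have hexp : Real.exp (β * deletedWeight J H F) =
      Real.exp (β * ∑ e ∈ H.edgeFinset with e ∈ F, max (J e) 0) *
        Real.exp (β * ∑ e ∈ H.edgeFinset with e ∈ F, max (-J e) 0) := by
    rw [← Real.exp_add, ← mul_add, ← Finset.sum_add_distrib]
    unfold deletedWeight
    simp only [max_zero_add_max_neg_zero_eq_abs_self]
  rw [hexp]
  refine h.compare (gibbsWeight_pos H J β) (gibbsWeight_pos _ J β) (Real.exp_pos _).le hT ?_ ?_
  · intro σ
    unfold gibbsWeight
    rw [← Real.exp_add, ← mul_add, hsplit]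
    refine Real.exp_le_exp.2 (mul_le_mul_of_nonneg_left ?_ hβ)
    rw [add_left_comm]
    refine le_add_of_nonneg_right ?_
    rw [← Finset.sum_add_distrib]
    refine Finset.sum_nonneg fun e _ => ?_
    have h1 := le_max_left (-J e) 0
    have h2 := le_max_right (-J e) 0
    split_ifs <;> linarith
  · intro σ
    unfold gibbsWeight
    rw [← Real.exp_add, ← mul_add, hsplit, add_comm]
    refine Real.exp_le_exp.2 (mul_le_mul_of_nonneg_left (add_le_add ?_ le_rfl) hβ)
    refine Finset.sum_le_sum fun e _ => ?_
    split_ifs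
    · exact le_max_left _ _
    · exact le_max_right _ _

open Classical in
/-- The total absolute coupling of the edges of `H` that touch the support of a walk. -/
noncomputable def touchingWeight (H : SimpleGraph V) {u v : V} (p : H.Walk u v) : ℝ :=
  ∑ e ∈ H.edgeFinset with (∃ x ∈ p.support, x ∈ e), |J e|

/-- Eliminating vertices along paths: the Poincaré constant of `A` is at most the exponential of
the largest weight of a path in `A` that starts in a given set of roots. -/
theorem isPoincare_of_paths {β : ℝ} (hβ : 0 ≤ β) (A : Finset V) :
    ∀ (H : SimpleGraph V) (R : Set V) (X : ℝ), 0 ≤ X →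
    (∀ x ∈ A, ∃ r ∈ R, ∃ p : H.Walk r x, ∀ y ∈ p.support, y ∈ A) →
    (∀ r ∈ R, ∀ (x : V) (p : H.Walk r x), p.IsPath → (∀ y ∈ p.support, y ∈ A) →
      β * touchingWeight J H p ≤ X) →
    IsPoincare (gibbsWeight H J β) A (Real.exp X) := by
  classical
  induction A using Finset.strongInduction with
  | H A ih =>
  intro H R X hX hR hpath
  have hW := gibbsWeight_pos H J β
  rcases A.eq_empty_or_nonempty with rfl | ⟨x₀, hx₀⟩
  · exact isPoincare_empty hW _
  obtain ⟨r, hrR, p₀, hp₀⟩ := hR x₀ hx₀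
  have hrA : r ∈ A := hp₀ r p₀.start_mem_support
  set C := A.filter fun x => ∃ p : H.Walk r x, ∀ y ∈ p.support, y ∈ A with hC
  have hCA : C ⊆ A := Finset.filter_subset _ _
  have hrC : r ∈ C := Finset.mem_filter.2 ⟨hrA, SimpleGraph.Walk.nil, by simpa using hrA⟩
  by_cases hCeq : C = A
  -- Connected case: all edges at the root `r` are deleted, which isolates it. Its neighbours in `A`
  -- become the roots of what remains, with budget X - Xr.
  · obtain ⟨F, hF⟩ : ∃ F : Set (Sym2 V), ∀ e, e ∈ F ↔ r ∈ e := ⟨{e | r ∈ e}, fun _ => Iff.rfl⟩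
    set H' := H.deleteEdges F with hH'
    have hW' := gibbsWeight_pos H' J β
    set Xr := β * deletedWeight J H F with hXr
    have hXrX : Xr ≤ X := by
      have := hpath r hrR r SimpleGraph.Walk.nil (by simp) (by simpa using hrA)
      simpa [touchingWeight, deletedWeight, hF, hXr] using this
    have hle : H' ≤ H := H.deleteEdges_le F
    have hrest : IsPoincare (gibbsWeight H' J β) (A.erase r) (Real.exp (X - Xr)) := by
      refine ih _ (Finset.erase_ssubset hrA) H' {u | u ∈ A ∧ H.Adj r u} (X - Xr) (by linarith) ?_ ?_
      · intro x hx
        have hxC : x ∈ C := hCeq ▸ Finset.mem_of_mem_erase hx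
        obtain ⟨p, hp⟩ := (Finset.mem_filter.1 hxC).2
        have hbp := p.bypass_isPath
        have hbs : ∀ y ∈ p.bypass.support, y ∈ A := fun y hy =>
          hp y (p.support_bypass_subset_support hy)
        generalize p.bypass = q at hbp hbs
        cases q with
        | nil => simp at hx
        | @cons _ u _ hadj q =>
          rw [SimpleGraph.Walk.cons_isPath_iff] at hbp
          refine ⟨u, ⟨hbs u (by simp), hadj⟩, q.transfer H' ?_, ?_⟩
          · intro e he
            rw [hH', SimpleGraph.edgeSet_deleteEdges]
            exact ⟨q.edges_subset_edgeSet he, fun hre =>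
              hbp.2 (q.mem_support_of_mem_edges he ((hF e).1 hre))⟩
          · intro y hy
            rw [SimpleGraph.Walk.support_transfer] at hy
            refine Finset.mem_erase.2 ⟨fun h => hbp.2 (h ▸ hy), hbs y ?_⟩
            rw [SimpleGraph.Walk.support_cons]
            exact List.mem_cons_of_mem _ hy
      · rintro u ⟨-, hadj⟩ x p hp hpA
        have hsupp : (p.mapLe hle).support = p.support := by simp
        have hcons : (SimpleGraph.Walk.cons hadj (p.mapLe hle)).IsPath := by
          rw [SimpleGraph.Walk.cons_isPath_iff]
          refine ⟨hp.mapLe hle, fun h => ?_⟩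
          rw [hsupp] at h
          exact absurd (hpA r h) (by simp)
        have := hpath r hrR x _ hcons (by
          intro y hy
          rw [SimpleGraph.Walk.support_cons, hsupp, List.mem_cons] at hy
          rcases hy with rfl | hy
          · exact hrA
          · exact Finset.mem_of_mem_erase (hpA y hy))
        -- Edges at `r` no longer exist in `H'`, so the charges for `r` and for the rest of the path
        -- add without double counting.
        have hsum : touchingWeight J H (SimpleGraph.Walk.cons hadj (p.mapLe hle)) =
            deletedWeight J H F + touchingWeight J H' p := by
          unfold touchingWeight deletedWeight
          rw [← Finset.sum_filter_add_sum_filter_not _ (fun e => e ∈ F), Finset.filter_filter,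
            Finset.filter_filter]
          congr 1
          · refine Finset.sum_congr ?_ fun _ _ => rfl
            ext e
            rw [Finset.mem_filter, Finset.mem_filter]
            exact ⟨fun h => ⟨h.1, h.2.2⟩, fun h => ⟨h.1, ⟨r, by simp, (hF e).1 h.2⟩, h.2⟩⟩
          · refine Finset.sum_congr ?_ fun _ _ => rfl
            ext e
            simp only [Finset.mem_filter, SimpleGraph.mem_edgeFinset, hH',
              SimpleGraph.edgeSet_deleteEdges, SimpleGraph.Walk.support_cons, hsupp, Set.mem_sdiff,
              List.mem_cons]
            constructor
            · rintro ⟨h1, ⟨y, rfl | hy, hye⟩, h3⟩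
              · exact absurd ((hF e).2 hye) h3
              · exact ⟨⟨h1, h3⟩, y, hy, hye⟩
            · rintro ⟨⟨h1, h3⟩, y, hy, hye⟩
              exact ⟨h1, ⟨y, Or.inr hy, hye⟩, h3⟩
        rw [hsum, mul_add] at this
        linarith
    have hsing : IsPoincare (gibbsWeight H' J β) {r} (Real.exp (X - Xr)) :=
      (isPoincare_singleton _ r).mono hW' (Real.one_le_exp (by linarith))
    have hunion := hsing.union hW' (by simp) (isIndep_gibbsWeight J β H' (by simp) (by
      intro x hx y _ hxy
      rw [Finset.mem_singleton] at hx
      subst hx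
      rw [hH', SimpleGraph.deleteEdges_adj] at hxy
      exact hxy.2 ((hF _).2 (Sym2.mem_mk_left _ _)))) hrest
    have hins : {r} ∪ A.erase r = A := by
      rw [← Finset.insert_eq, Finset.insert_erase hrA]
    rw [hins] at hunion
    have := hunion.of_deleteEdges J hβ H F (Real.exp_pos _).le
    rw [← Real.exp_add] at this
    convert this using 2
    linarith
  -- Disconnected case: the component of `r` and its complement in `A` are not joined by edges. Both
  -- inherit the bound X, so branches contribute a maximum and not a sum.
  · have hCss : C ⊂ A := hCA.ssubset_of_ne hCeq
    have hDss : A \ C ⊂ A := by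
      refine (Finset.sdiff_subset).ssubset_of_ne fun h => ?_
      have : r ∈ A \ C := by rw [h]; exact hrA
      exact (Finset.mem_sdiff.1 this).2 hrC
    have hwalk : ∀ {x : V} (p : H.Walk r x), (∀ y ∈ p.support, y ∈ A) → ∀ y ∈ p.support, y ∈ C := by
      intro x p hp y hy
      exact Finset.mem_filter.2 ⟨hp y hy, p.takeUntil y hy, fun z hz =>
        hp z (p.support_takeUntil_subset_support hy hz)⟩
    have h1 : IsPoincare (gibbsWeight H J β) C (Real.exp X) := by
      refine ih C hCss H {r} X hX ?_ ?_
      · intro x hx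
        obtain ⟨p, hp⟩ := (Finset.mem_filter.1 hx).2
        exact ⟨r, rfl, p, hwalk p hp⟩
      · intro r' hr' x p hp hpC
        exact hpath r' (by rw [Set.mem_singleton_iff.1 hr']; exact hrR) x p hp fun y hy => hCA (hpC y hy)
    have h2 : IsPoincare (gibbsWeight H J β) (A \ C) (Real.exp X) := by
      refine ih _ hDss H R X hX ?_ ?_
      · intro x hx
        rw [Finset.mem_sdiff] at hx
        obtain ⟨r', hr', p, hp⟩ := hR x hx.1
        refine ⟨r', hr', p, fun y hy => Finset.mem_sdiff.2 ⟨hp y hy, fun hyC => hx.2 ?_⟩⟩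
        obtain ⟨q, hq⟩ := (Finset.mem_filter.1 hyC).2
        refine Finset.mem_filter.2 ⟨hx.1, q.append (p.dropUntil y hy), fun z hz => ?_⟩
        rw [SimpleGraph.Walk.mem_support_append_iff] at hz
        rcases hz with hz | hz
        · exact hq z hz
        · exact hp z (p.support_dropUntil_subset_support hy hz)
      · intro r' hr' x p hp hpD
        exact hpath r' hr' x p hp fun y hy => (Finset.mem_sdiff.1 (hpD y hy)).1
    have := h1.union hW Finset.disjoint_sdiff (isIndep_gibbsWeight J β H Finset.disjoint_sdiff (by
      intro x hx y hy hxy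
      rw [Finset.mem_sdiff] at hy
      obtain ⟨p, hp⟩ := (Finset.mem_filter.1 hx).2
      refine hy.2 (Finset.mem_filter.2 ⟨hy.1, p.concat hxy, fun z hz => ?_⟩)
      rw [SimpleGraph.Walk.support_concat, List.mem_append] at hz
      rcases hz with hz | hz
      · exact hp z hz
      · rw [List.mem_singleton] at hz
        exact hz ▸ hy.1)) h2
    rwa [Finset.union_sdiff_of_subset hCA] at this

end Elimination

/-! ### Counting the ends of short paths. -/

section Counting

variable {V : Type*} [Fintype V] [DecidableEq V]

open Classical in
/-- The number of vertices at the end of short paths is controlled by the products of the degrees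
along these paths. -/
lemma card_path_ends_le (G : SimpleGraph V) (m : ℕ) : ∀ (A : Finset V) (v : V) (K : ℝ), v ∈ A →
    1 ≤ K →
    (∀ (x : V) (p : G.Walk v x), p.IsPath → p.length ≤ m → (∀ y ∈ p.support, y ∈ A) →
      (p.support.map fun y => max 1 (G.degree y : ℝ)).prod ≤ K) →
    ((A.filter fun x => ∃ p : G.Walk v x, p.IsPath ∧ p.length ≤ m ∧
      ∀ y ∈ p.support, y ∈ A).card : ℝ) ≤ (m + 1) * K := by
  induction m with
  | zero =>
    intro A v K _ hK _
    have : (A.filter fun x => ∃ p : G.Walk v x, p.IsPath ∧ p.length ≤ 0 ∧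
        ∀ y ∈ p.support, y ∈ A) ⊆ {v} := by
      intro x hx
      obtain ⟨p, -, hp, -⟩ := (Finset.mem_filter.1 hx).2
      rw [Finset.mem_singleton, SimpleGraph.Walk.eq_of_length_eq_zero (Nat.le_zero.1 hp)]
    have := Finset.card_le_card this
    rw [Finset.card_singleton] at this
    have : ((A.filter fun x => ∃ p : G.Walk v x, p.IsPath ∧ p.length ≤ 0 ∧
        ∀ y ∈ p.support, y ∈ A).card : ℝ) ≤ 1 := by exact_mod_cast this
    push_cast
    linarith
  | succ m ih =>
    intro A v K hv hK hpath
    set N := (G.neighborFinset v).filter fun u => u ∈ A.erase v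
    set D : ℝ := max 1 (G.degree v : ℝ)
    have hD : 1 ≤ D := le_max_left _ _
    have hD0 : 0 < D := by linarith
    have hDK : D ≤ K := by
      have := hpath v SimpleGraph.Walk.nil (by simp) (by simp) (by simpa using hv)
      simpa [D] using this
    have hsub : (A.filter fun x => ∃ p : G.Walk v x, p.IsPath ∧ p.length ≤ m + 1 ∧
        ∀ y ∈ p.support, y ∈ A) ⊆ {v} ∪ N.biUnion fun u => (A.erase v).filter fun x =>
          ∃ p : G.Walk u x, p.IsPath ∧ p.length ≤ m ∧ ∀ y ∈ p.support, y ∈ A.erase v := by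
      intro x hx
      obtain ⟨p, hp, hlen, hpA⟩ := (Finset.mem_filter.1 hx).2
      cases p with
      | nil => simp
      | @cons _ u _ hadj q =>
        rw [SimpleGraph.Walk.cons_isPath_iff] at hp
        have hq : ∀ y ∈ q.support, y ∈ A.erase v := fun y hy =>
          Finset.mem_erase.2 ⟨fun h => hp.2 (h ▸ hy), hpA y (by simp [hy])⟩
        refine Finset.mem_union_right _ (Finset.mem_biUnion.2 ⟨u, ?_, ?_⟩)
        · exact Finset.mem_filter.2 ⟨by simpa using hadj, hq u q.start_mem_support⟩
        · refine Finset.mem_filter.2 ⟨hq x q.end_mem_support, q, hp.1, ?_, hq⟩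
          simpa using hlen
    have hN : (N.card : ℝ) ≤ D := by
      refine le_trans ?_ (le_max_right _ _)
      rw [← G.card_neighborFinset_eq_degree]
      exact_mod_cast Finset.card_filter_le _ _
    have hbr : ∀ u ∈ N, (((A.erase v).filter fun x =>
          ∃ p : G.Walk u x, p.IsPath ∧ p.length ≤ m ∧ ∀ y ∈ p.support, y ∈ A.erase v).card : ℝ) ≤
        (m + 1) * (K / D) := by
      intro u hu
      obtain ⟨hu1, hu2⟩ := Finset.mem_filter.1 hu
      have hadj : G.Adj v u := by simpa using hu1
      refine ih _ u _ hu2 ((one_le_div hD0).2 hDK) ?_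
      intro x p hp hlen hpA
      rw [le_div_iff₀' hD0]
      have := hpath x (SimpleGraph.Walk.cons hadj p)
        (SimpleGraph.Walk.IsPath.cons hp fun h => absurd (hpA v h) (by simp)) (by simpa using hlen) (by
          intro y hy
          rw [SimpleGraph.Walk.support_cons, List.mem_cons] at hy
          rcases hy with rfl | hy
          · exact hv
          · exact Finset.mem_of_mem_erase (hpA y hy))
      simpa using this
    have h1 := (Finset.card_le_card hsub).trans ((Finset.card_union_le _ _).trans
      (Nat.add_le_add_left Finset.card_biUnion_le _))
    rw [Finset.card_singleton] at h1
    have h2 : ((A.filter fun x => ∃ p : G.Walk v x, p.IsPath ∧ p.length ≤ m + 1 ∧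
        ∀ y ∈ p.support, y ∈ A).card : ℝ) ≤ 1 + ∑ u ∈ N, (((A.erase v).filter fun x =>
          ∃ p : G.Walk u x, p.IsPath ∧ p.length ≤ m ∧
            ∀ y ∈ p.support, y ∈ A.erase v).card : ℝ) := by exact_mod_cast h1
    refine h2.trans ?_
    -- At most D neighbours, each with budget K / D, give (m+1)K; the starting vertex adds 1 ≤ K.
    have h3 := Finset.sum_le_sum hbr
    rw [Finset.sum_const, nsmul_eq_mul] at h3
    have h4 : (N.card : ℝ) * ((m + 1) * (K / D)) ≤ D * ((m + 1) * (K / D)) :=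
      mul_le_mul_of_nonneg_right hN (by positivity)
    have h5 : D * ((m + 1) * (K / D)) = (m + 1) * K := by field_simp
    push_cast
    linarith

end Counting

end SpinGlass

namespace SpinGlass

/-! ### From Poincaré inequalities to relaxation times. -/

lemma relaxationTime_le {Ω : Type*} [Fintype Ω] {P : Matrix Ω Ω ℝ} {T : ℝ} (hT : 0 < T)
    (h : secondEigenvalue P ≤ 1 - 1 / T) : relaxationTime P ≤ ENNReal.ofReal T := by
  unfold relaxationTime
  rw [ENNReal.inv_le_iff_inv_le, ← ENNReal.ofReal_inv_of_pos hT]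
  refine ENNReal.ofReal_le_ofReal ?_
  rw [← one_div]
  linarith

section Glauber

variable {S : Type*} [Fintype S] [DecidableEq S] {μ : (S → Spin) → ℝ}

lemma fiber_univ (σ : S → Spin) : fiber Finset.univ σ = Finset.univ := by
  ext τ; simp [mem_fiber]

lemma glauberDynamics_mulVec [Fintype (S → Spin)] (μ f : (S → Spin) → ℝ) (σ : S → Spin) :
    (glauberDynamics μ).mulVec f σ = (Fintype.card S : ℝ)⁻¹ * ∑ v, condExp μ {v} f σ := by
  have : ∀ v ∈ Finset.univ, condExp μ {v} f σ = ∑ τ, updateKernel μ {v} σ τ * f τ := fun B _ => by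
    rw [← sum_updateKernel_mul]
    congr!
  rw [Finset.sum_congr rfl this, Finset.sum_comm, Finset.mul_sum]
  unfold Matrix.mulVec dotProduct glauberDynamics
  refine Finset.sum_congr rfl fun τ _ => ?_
  rw [mul_assoc, Finset.sum_mul]

/-- The Poincaré inequality bounds the absolute spectral gap of the single-site dynamics. -/
theorem secondEigenvalue_glauberDynamics_le [Nonempty S]
    (hμ : ∀ σ, 0 < μ σ) {T : ℝ} (hT : 1 ≤ T) (h : IsPoincare μ Finset.univ T) :
    secondEigenvalue (glauberDynamics μ) ≤ 1 - 1 / (Fintype.card S * T) := by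
  have hm : (1 : ℝ) ≤ Fintype.card S := by exact_mod_cast Fintype.card_pos (α := S)
  have hmT : 0 < Fintype.card S * T := by positivity
  have hmT1 : 1 ≤ Fintype.card S * T := one_le_mul_of_one_le_of_one_le hm hT
  refine Real.sSup_le ?_ (by rw [sub_nonneg, div_le_one hmT]; exact hmT1)
  rintro _ ⟨l, f, hconst, heig, rfl⟩
  have hf : ∀ σ, ∑ v, condExp μ {v} f σ = Fintype.card S * l * f σ := by
    intro σ
    have := congrFun heig σ
    rw [glauberDynamics_mulVec, inv_mul_eq_iff_eq_mul₀ (by positivity)] at this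
    rw [this, Pi.smul_apply, smul_eq_mul, mul_assoc]
  set N := ∑ σ : S → Spin, μ σ * f σ ^ 2 with hN
  have horth : ∀ A : Finset S, ∀ g : (S → Spin) → ℝ, (∀ τ, ∀ ρ ∈ fiber A τ, g ρ = g τ) →
      ∑ τ : S → Spin, μ τ * (f τ - condExp μ A f τ) * g τ = 0 := by
    intro A g hg
    have := sum_sub_condExp_mul hμ (Finset.subset_univ A) f g hg 1
    rwa [fiber_univ] at this
  have hres : ∀ A : Finset S, residual μ Finset.univ A f 1 =
      N - ∑ τ : S → Spin, μ τ * condExp μ A f τ ^ 2 := by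
    intro A
    have := sum_sub_sq_eq_residual_add hμ (Finset.subset_univ A) f (fun _ => 0)
      (fun _ _ _ => rfl) 1
    simp only [sub_zero, fiber_univ] at this
    rw [hN, this, add_sub_cancel_right]
  have hsq : ∀ A : Finset S, ∑ τ : S → Spin, μ τ * condExp μ A f τ ^ 2 =
      ∑ τ : S → Spin, μ τ * f τ * condExp μ A f τ := by
    intro A
    have := horth A (condExp μ A f) fun τ ρ hρ => condExp_congr hρ
    rw [← sub_eq_zero, ← neg_eq_zero, ← this, neg_sub, ← Finset.sum_sub_distrib]
    exact Finset.sum_congr rfl fun τ _ => by ring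
  -- The sum of the ‖E_v f‖² equals |S|·l·‖f‖², so l ≥ 0 and negative eigenvalues need no separate
  -- bound.
  have hsum : ∑ v, ∑ τ : S → Spin, μ τ * condExp μ {v} f τ ^ 2 = Fintype.card S * l * N := by
    simp only [hsq]
    rw [Finset.sum_comm, hN, Finset.mul_sum]
    refine Finset.sum_congr rfl fun τ _ => ?_
    rw [← Finset.mul_sum, hf]
    ring
  have hN0 : 0 < N := by
    obtain ⟨σ, hσ⟩ : ∃ σ, f σ ≠ 0 := by
      by_contra! h0
      exact hconst ⟨0, h0⟩
    exact Finset.sum_pos' (fun τ _ => mul_nonneg (hμ τ).le (sq_nonneg _))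
      ⟨σ, Finset.mem_univ σ, mul_pos (hμ σ) (by positivity)⟩
  have hl0 : 0 ≤ l := by
    have h0 : 0 ≤ Fintype.card S * l * N := hsum ▸ Finset.sum_nonneg fun v _ =>
      Finset.sum_nonneg fun τ _ => mul_nonneg (hμ τ).le (sq_nonneg _)
    by_contra! hl
    have : Fintype.card S * l * N < 0 :=
      mul_neg_of_neg_of_pos (mul_neg_of_pos_of_neg (by linarith) hl) hN0
    linarith
  have hP := h f 1
  have hdir : ∑ u : S, residual μ Finset.univ {u} f 1 = Fintype.card S * (1 - l) * N := by
    simp only [hres, Finset.sum_sub_distrib, hsum, Finset.sum_const, Finset.card_univ,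
      nsmul_eq_mul]
    ring
  rw [hdir] at hP
  rw [abs_of_nonneg hl0]
  have hmean : ∀ σ, condExp μ Finset.univ f σ = condExp μ Finset.univ f 1 := fun σ =>
    condExp_congr (by rw [fiber_univ]; exact Finset.mem_univ σ)
  -- For l = 1 the Dirichlet form vanishes and f is constant. Otherwise f has mean zero, because
  -- each update preserves the mean, and the variance is all of ‖f‖².
  by_cases hl1 : l = 1
  · exfalso
    rw [hl1, sub_self, mul_zero, zero_mul, mul_zero] at hP
    refine hconst ⟨condExp μ Finset.univ f 1, fun σ => ?_⟩
    have h0 : residual μ Finset.univ Finset.univ f 1 = 0 :=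
      le_antisymm hP (residual_nonneg hμ _ _ _ _)
    unfold residual at h0
    rw [Finset.sum_eq_zero_iff_of_nonneg
      fun τ _ => mul_nonneg (hμ τ).le (sq_nonneg _)] at h0
    have := h0 σ (by rw [fiber_univ]; exact Finset.mem_univ σ)
    rw [hmean, mul_eq_zero, or_iff_right (hμ σ).ne', sq_eq_zero_iff, sub_eq_zero] at this
    exact this
  · have hzero : ∑ τ : S → Spin, μ τ * f τ = 0 := by
      have h1 : ∑ v : S, ∑ τ : S → Spin, μ τ * condExp μ {v} f τ =
          Fintype.card S * ∑ τ : S → Spin, μ τ * f τ := by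
        rw [← nsmul_eq_mul, ← Finset.card_univ, ← Finset.sum_const]
        refine Finset.sum_congr rfl fun v _ => ?_
        have := horth {v} (fun _ => 1) fun _ _ _ => rfl
        simp only [mul_one, mul_sub, Finset.sum_sub_distrib] at this
        linarith
      rw [Finset.sum_comm] at h1
      simp only [← Finset.mul_sum, hf] at h1
      have h2 : ∑ τ : S → Spin, μ τ * (Fintype.card S * l * f τ) =
          Fintype.card S * l * ∑ τ : S → Spin, μ τ * f τ := by
        rw [Finset.mul_sum]
        exact Finset.sum_congr rfl fun τ _ => by ring
      rw [h2, ← sub_eq_zero] at h1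
      have h3 : (Fintype.card S : ℝ) * (l - 1) * ∑ τ : S → Spin, μ τ * f τ = 0 := by linarith
      rcases mul_eq_zero.1 h3 with h3 | h3
      · rcases mul_eq_zero.1 h3 with h3 | h3
        · linarith
        · exact absurd (sub_eq_zero.1 h3) hl1
      · exact h3
    have hE : ∀ σ, condExp μ Finset.univ f σ = 0 := by
      intro σ
      unfold condExp
      rw [fiber_univ, hzero, zero_div]
    have hvar : residual μ Finset.univ Finset.univ f 1 = N := by
      rw [hres]; simp [hE]
    rw [hvar] at hP
    have h4 : 1 ≤ Fintype.card S * T * (1 - l) := by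
      refine le_of_mul_le_mul_right ?_ hN0
      linarith
    have h5 : 1 / (Fintype.card S * T) ≤ 1 - l := by
      rw [div_le_iff₀ hmT]; linarith
    linarith

end Glauber

/-! ### The Gibbs distribution of a block with a boundary condition. -/

section Transfer

variable {V : Type*} [Fintype V] [DecidableEq V]

/-- The configuration equal to `η` on `B` and to `ξ` elsewhere. -/
def glue (B : Finset V) (ξ : V → Spin) (η : {v // v ∈ B} → Spin) (v : V) : Spin :=
  if h : v ∈ B then η ⟨v, h⟩ else ξ v

lemma glue_mem (B : Finset V) (ξ : V → Spin) (η : {v // v ∈ B} → Spin) (v : {v // v ∈ B}) :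
    glue B ξ η v = η v := by simp [glue]

lemma glue_notMem {B : Finset V} (ξ : V → Spin) (η : {v // v ∈ B} → Spin) {v : V} (h : v ∉ B) :
    glue B ξ η v = ξ v := by simp [glue, h]

variable (W : (V → Spin) → ℝ) (B : Finset V) (ξ : V → Spin)

lemma sum_fiber_glue (A : Finset {v // v ∈ B}) (η : {v // v ∈ B} → Spin) (g : (V → Spin) → ℝ) :
    ∑ τ ∈ fiber (A.map (Function.Embedding.subtype _)) (glue B ξ η), g τ =
      ∑ ρ ∈ fiber A η, g (glue B ξ ρ) := by
  have hval : ∀ v : {v // v ∈ B}, v ∉ A → (v : V) ∉ A.map (Function.Embedding.subtype _) := by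
    intro v hv hv'
    obtain ⟨u, hu, huv⟩ := Finset.mem_map.1 hv'
    exact hv (Subtype.ext huv ▸ hu)
  have hval' : ∀ v : V, v ∉ B → v ∉ A.map (Function.Embedding.subtype _) := by
    intro v hv hv'
    obtain ⟨u, hu, rfl⟩ := Finset.mem_map.1 hv'
    exact hv u.2
  have hinv : ∀ τ ∈ fiber (A.map (Function.Embedding.subtype _)) (glue B ξ η),
      glue B ξ (fun v => τ v) = τ := by
    intro τ hτ
    funext v
    by_cases hv : v ∈ B
    · simp [glue, hv]
    · rw [glue_notMem _ _ hv, mem_fiber.1 hτ v (hval' v hv), glue_notMem _ _ hv]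
  refine Finset.sum_nbij' (fun τ v => τ v) (glue B ξ) ?_ ?_ hinv ?_ ?_
  · intro τ hτ
    refine mem_fiber.2 fun v hv => ?_
    rw [mem_fiber.1 hτ v (hval v hv), glue_mem]
  · intro ρ hρ
    refine mem_fiber.2 fun v hv => ?_
    by_cases hvB : v ∈ B
    · have := mem_fiber.1 hρ ⟨v, hvB⟩ fun h => hv (Finset.mem_map.2 ⟨_, h, rfl⟩)
      simp [glue, hvB, this]
    · rw [glue_notMem _ _ hvB, glue_notMem _ _ hvB]
  · intro ρ _
    funext v
    exact glue_mem B ξ ρ v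
  · intro τ hτ
    rw [hinv τ hτ]

lemma condExp_glue (A : Finset {v // v ∈ B}) (f : ({v // v ∈ B} → Spin) → ℝ)
    (η : {v // v ∈ B} → Spin) :
    condExp W (A.map (Function.Embedding.subtype _)) (fun τ => f fun v => τ v) (glue B ξ η) =
      condExp (fun ρ => W (glue B ξ ρ)) A f η := by
  unfold condExp fiberMass
  rw [sum_fiber_glue, sum_fiber_glue]
  simp only [glue_mem]

lemma residual_glue (A C : Finset {v // v ∈ B}) (f : ({v // v ∈ B} → Spin) → ℝ)
    (η : {v // v ∈ B} → Spin) :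
    residual W (A.map (Function.Embedding.subtype _)) (C.map (Function.Embedding.subtype _))
      (fun τ => f fun v => τ v) (glue B ξ η) = residual (fun ρ => W (glue B ξ ρ)) A C f η := by
  unfold residual
  rw [sum_fiber_glue]
  simp only [condExp_glue, glue_mem]

variable {W B}

lemma IsPoincare.glue {T : ℝ} (h : IsPoincare W B T) :
    IsPoincare (fun ρ => W (glue B ξ ρ)) Finset.univ T := by
  intro f η
  have hB : (Finset.univ : Finset {v // v ∈ B}).map (Function.Embedding.subtype _) = B := by
    ext v; simp
  have := h (fun τ => f fun v => τ v) (SpinGlass.glue B ξ η)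
  have hs : ∑ u ∈ B, residual W B {u} (fun τ => f fun v => τ v) (SpinGlass.glue B ξ η) =
      ∑ u, residual (fun ρ => W (SpinGlass.glue B ξ ρ)) Finset.univ {u} f η := by
    rw [← Finset.sum_coe_sort B]
    refine Finset.sum_congr rfl fun u _ => ?_
    rw [← residual_glue, hB, Finset.map_singleton]
    rfl
  rw [hs] at this
  rw [← residual_glue, hB]
  exact this

lemma IsPoincare.const_mul {S : Type*} [Fintype S] [DecidableEq S] {W : (S → Spin) → ℝ}
    {A : Finset S} (hW : ∀ σ, 0 < W σ) {T : ℝ} (hT : 0 ≤ T)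
    (h : IsPoincare W A T) {c : ℝ} (hc : 0 < c) : IsPoincare (fun σ => c * W σ) A T := by
  have := h.compare (W := fun σ => c * W σ) (a := c⁻¹) (b := c) (fun σ => mul_pos hc (hW σ)) hW hc.le
    hT (fun σ => by rw [inv_mul_cancel_left₀ hc.ne']) (fun σ => le_rfl)
  rwa [mul_inv_cancel₀ hc.ne', one_mul] at this

variable (G : SimpleGraph V) (J : Sym2 V → ℝ) (β : ℝ) (B)

/-- Vertices outside B and its outer boundary are not adjacent to B. Summing them out therefore
multiplies the weight by a factor that depends on ξ but not on η. -/
lemma exists_blockGibbs_eq :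
    ∃ c : ℝ, 0 < c ∧ blockGibbs G J β B ξ = fun η => c * gibbsWeight G J β (glue B ξ η) := by
  classical
  have hW := gibbsWeight_pos G J β
  have hZ := sum_gibbsWeight_pos G J β
  set Z := ∑ τ : V → Spin, gibbsWeight G J β τ
  have hgibbs : ∀ σ, gibbs G J β σ = Z⁻¹ * gibbsWeight G J β σ := by
    intro σ
    rw [inv_mul_eq_div]
    unfold gibbs
    congr 1
    simp only [Z]
    congr!
  set R : Finset V := Finset.univ.filter fun v => v ∉ B ∧ v ∉ outerBoundary G B with hR
  have hd : Disjoint B R := by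
    rw [Finset.disjoint_left]
    intro v hv hv'
    exact (Finset.mem_filter.1 hv').2.1 hv
  have hI : IsIndep (gibbsWeight G J β) B R := by
    refine isIndep_gibbsWeight J β G hd fun x hx y hy hxy => ?_
    have := (Finset.mem_filter.1 hy).2
    exact this.2 ⟨this.1, x, hx, hxy.symm⟩
  set D := ∑ τ : V → Spin with (∀ v ∈ outerBoundary G B, τ v = ξ v), gibbs G J β τ with hD
  have hD0 : 0 < D := by
    refine Finset.sum_pos (fun τ _ => ?_) ⟨ξ, by simp⟩
    rw [hgibbs]
    exact mul_pos (inv_pos.2 hZ) (hW τ)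
  refine ⟨Z⁻¹ * (fiberMass (gibbsWeight G J β) R ξ / gibbsWeight G J β ξ) / D,
    div_pos (mul_pos (inv_pos.2 hZ) (div_pos (fiberMass_pos hW _ _) (hW ξ))) hD0, ?_⟩
  funext η
  have hfib : Finset.univ.filter (fun τ : V → Spin => (∀ v ∈ outerBoundary G B, τ v = ξ v) ∧
      ∀ v : {v // v ∈ B}, τ v = η v) = fiber R (glue B ξ η) := by
    ext τ
    simp only [Finset.mem_filter, Finset.mem_univ, true_and, mem_fiber, hR, not_and, not_not]
    constructor
    · rintro ⟨h1, h2⟩ v hv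
      by_cases hvB : v ∈ B
      · simpa [glue, hvB] using h2 ⟨v, hvB⟩
      · rw [glue_notMem _ _ hvB]
        exact h1 v (hv hvB)
    · intro h
      refine ⟨fun v hv => ?_, fun v => ?_⟩
      · rw [h v fun _ => hv, glue_notMem _ _ hv.1]
      · rw [h v fun h' => absurd v.2 h', glue_mem]
  have hglue : glue B ξ η ∈ fiber B ξ := mem_fiber.2 fun v hv => glue_notMem _ _ hv
  have hmass := hI.mul_fiberMass hglue
  have hnum : ∑ τ ∈ fiber R (glue B ξ η), gibbs G J β τ =
      Z⁻¹ * fiberMass (gibbsWeight G J β) R (glue B ξ η) := by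
    unfold fiberMass
    rw [Finset.mul_sum]
    exact Finset.sum_congr rfl fun τ _ => hgibbs τ
  have hcond : blockGibbs G J β B ξ η =
      (∑ τ ∈ fiber R (glue B ξ η), gibbs G J β τ) / D := by
    unfold blockGibbs condMarginal
    rw [← hfib]
    congr!
  rw [hcond, hnum]
  have := (hW ξ).ne'
  field_simp
  linarith

/-- The Poincaré inequality bounds the relaxation time of the single-site dynamics on a block. -/
theorem relaxationTime_glauberDynamics_blockGibbs_le
    (hB : B.Nonempty) {T : ℝ} (hT : 1 ≤ T) (h : IsPoincare (gibbsWeight G J β) B T) :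
    relaxationTime (glauberDynamics (blockGibbs G J β B ξ)) ≤ ENNReal.ofReal (B.card * T) := by
  obtain ⟨c, hc, hcW⟩ := exists_blockGibbs_eq B ξ G J β
  have hW := gibbsWeight_pos G J β
  have : Nonempty {v // v ∈ B} := hB.to_subtype
  have hP := (h.glue ξ).const_mul (fun η => hW (glue B ξ η)) (by linarith) hc
  rw [← hcW] at hP
  have hpos : ∀ η, 0 < blockGibbs G J β B ξ η := fun η => by
    rw [hcW]; exact mul_pos hc (hW _)
  have hcard : (0 : ℝ) < B.card := by exact_mod_cast hB.card_pos
  refine relaxationTime_le (by positivity) ?_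
  have := secondEigenvalue_glauberDynamics_le hpos hT hP
  rwa [Fintype.card_coe] at this

end Transfer

end SpinGlass

namespace SpinGlass

/-! ### Path lengths in trees and unicyclic graphs. -/

section GraphStructure

open SimpleGraph

variable {U : Type*} {H T : SimpleGraph U}

lemma exists_walk_deleteEdges {x y : U} (p : H.Walk x y) {F : Set (Sym2 U)}
    (hF : ∀ e ∈ p.edges, e ∉ F) : ∃ p' : (H.deleteEdges F).Walk x y, p'.length = p.length ∧
      p'.support = p.support ∧ p'.edges = p.edges ∧ (p.IsPath → p'.IsPath) :=
  ⟨p.toDeleteEdges F hF, Walk.length_transfer .., Walk.support_transfer .., Walk.edges_transfer ..,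
    fun h => h.toDeleteEdges _ _ _⟩

/-- In a forest every walk has the unique path between its ends as its bypass. -/
lemma length_le_of_isAcyclic (hT : T.IsAcyclic) {x y : U} {p : T.Walk x y} (hp : p.IsPath)
    (w : T.Walk x y) : p.length ≤ w.length := by
  classical
  have := (hT.subsingleton_path x y).elim ⟨p, hp⟩ ⟨w.bypass, w.bypass_isPath⟩
  rw [Subtype.mk.injEq] at this
  rw [this]
  exact w.length_bypass_le_length

/-- A walk to `Q` can be cut short so that it uses no edge inside `Q`. -/
lemma exists_walk_avoiding {Q : Set U} {w x : U} (p : H.Walk w x) (hx : x ∈ Q) :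
    ∃ y ∈ Q, ∃ p' : H.Walk w y, p'.length ≤ p.length ∧ ∀ e ∈ p'.edges, ∃ z ∈ e, z ∉ Q := by
  induction p with
  | nil => exact ⟨_, hx, Walk.nil, le_rfl, by simp⟩
  | @cons w u _ h p ih =>
    by_cases hw : w ∈ Q
    · exact ⟨w, hw, Walk.nil, by simp, by simp⟩
    · obtain ⟨y, hy, p', hlen, hp'⟩ := ih hx
      refine ⟨y, hy, Walk.cons h p', by simpa using hlen, fun e he => ?_⟩
      rw [Walk.edges_cons, List.mem_cons] at he
      rcases he with rfl | he
      · exact ⟨w, Sym2.mem_mk_left _ _, hw⟩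
      · exact hp' e he

lemma exists_walk_getVert {u v : U} (q : T.Walk u v) {i j : ℕ} (hij : i ≤ j)
    (hj : j ≤ q.length) : ∃ w : T.Walk (q.getVert i) (q.getVert j), w.length = j - i := by
  induction j, hij using Nat.le_induction with
  | base => exact ⟨Walk.nil, by simp⟩
  | succ j hij ih =>
    obtain ⟨w, hw⟩ := ih (by lia)
    refine ⟨w.concat (q.adj_getVert_succ (by lia)), ?_⟩
    rw [Walk.length_concat, hw]
    lia

lemma getVert_edge_inj {u v : U} {q : T.Walk u v} (hq : q.IsPath) {a b : ℕ} (ha : a < q.length)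
    (hb : b < q.length)
    (h : s(q.getVert a, q.getVert (a + 1)) = s(q.getVert b, q.getVert (b + 1))) : a = b := by
  have inj : ∀ i j, i ≤ q.length → j ≤ q.length → q.getVert i = q.getVert j → i = j :=
    fun i j hi hj hij => hq.getVert_injOn hi hj hij
  rw [Sym2.eq_iff] at h
  rcases h with ⟨h, -⟩ | ⟨h1, h2⟩
  · exact inj a b (by lia) (by lia) h
  · have := inj a (b + 1) (by lia) (by lia) h1
    have := inj (a + 1) b (by lia) (by lia) h2
    lia

lemma reachable_getVert {u v : U} {q : T.Walk u v} (hq : q.IsPath) {k : ℕ} (hk : k < q.length)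
    {i j : ℕ} (hij : i ≤ j) (hj : j ≤ q.length) (hkij : j ≤ k ∨ k < i) :
    (T.deleteEdges {s(q.getVert k, q.getVert (k + 1))}).Reachable (q.getVert i) (q.getVert j) := by
  induction j, hij using Nat.le_induction with
  | base => exact Reachable.refl _
  | succ j hij ih =>
    refine (ih (by lia) (by lia)).trans (Adj.reachable ?_)
    rw [deleteEdges_adj]
    refine ⟨q.adj_getVert_succ (by lia), fun h => ?_⟩
    have := getVert_edge_inj hq (by lia) hk h
    lia

/-- Every `m`-th edge of a walk. -/
def cutEdges {u v : U} (q : T.Walk u v) (m : ℕ) : Set (Sym2 U) :=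
  (fun k => s(q.getVert (k * m), q.getVert (k * m + 1))) '' Set.Iic (q.length / m)

/-- Cutting a spine of an acyclic graph at every `m`-th edge leaves only short paths. -/
lemma length_le_of_cut (hT : T.IsAcyclic) {u v : U} {q : T.Walk u v} (hq : q.IsPath) {D m : ℕ}
    (hm : 1 ≤ m) (hatt : ∀ w, ∃ i ≤ q.length, ∃ p : T.Walk w (q.getVert i), p.length ≤ D ∧
      ∀ e ∈ p.edges, ∃ z ∈ e, z ∉ q.support) {x y : U}
    {p : (T.deleteEdges (cutEdges q m)).Walk x y} (hp : p.IsPath) : p.length ≤ 2 * D + m := by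
  have main : ∀ {x y : U} (p : (T.deleteEdges (cutEdges q m)).Walk x y), p.IsPath →
      ∀ (i j : ℕ), i ≤ j → j ≤ q.length →
      (∃ p : T.Walk x (q.getVert i), p.length ≤ D ∧ ∀ e ∈ p.edges, ∃ z ∈ e, z ∉ q.support) →
      (∃ p : T.Walk y (q.getVert j), p.length ≤ D ∧ ∀ e ∈ p.edges, ∃ z ∈ e, z ∉ q.support) →
      p.length ≤ 2 * D + m := by
    intro x y p hp i j hij hj ⟨px, hpx, hpx'⟩ ⟨py, hpy, hpy'⟩
    by_cases hm' : j - i ≤ m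
    · obtain ⟨w, hw⟩ := exists_walk_getVert q hij hj
      have := length_le_of_isAcyclic hT (hp.mapLe (T.deleteEdges_le _))
        ((px.append w).append py.reverse)
      simp only [Walk.length_append, Walk.length_reverse, Walk.length_map, Walk.mapLe] at this
      lia
    · exfalso
      -- k = ⌈i/m⌉; since j - i > m, its multiple of m lies in [i, j), so the spine is cut between
      -- the two attachment points.
      obtain ⟨k, hk1, hk2⟩ : ∃ k, i ≤ k * m ∧ k * m < j := by
        refine ⟨(i + m - 1) / m, ?_, ?_⟩
        · have h1 := Nat.lt_div_mul_add (a := i + m - 1) (b := m) (by lia)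
          lia
        · have := Nat.div_mul_le_self (i + m - 1) m
          lia
      have hkq : k * m < q.length := by lia
      set f := s(q.getVert (k * m), q.getVert (k * m + 1)) with hf
      have hfcut : f ∈ cutEdges q m := ⟨k, (Nat.le_div_iff_mul_le (by lia)).2 hkq.le, rfl⟩
      have hfsup : ∀ z ∈ f, z ∈ q.support := by
        intro z hz
        rcases Sym2.mem_iff.1 hz with rfl | rfl <;> exact q.getVert_mem_support _
      -- The cut edge is a bridge. Yet its ends would stay joined: along the spine to the attachment
      -- of x, out to x, along `p`, and back through y. The attaching walks avoid the edge since
      -- each of their edges leaves the spine.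
      have hbr := isAcyclic_iff_forall_adj_isBridge.1 hT
        (q.adj_getVert_succ hkq)
      rw [isBridge_iff] at hbr
      apply hbr
      have r1 := (reachable_getVert hq hkq hk1 hkq.le (Or.inl le_rfl)).symm
      have r2 := reachable_getVert hq hkq (i := k * m + 1) hk2 hj (Or.inr (by lia))
      have att : ∀ {w z : U} (p : T.Walk w z), (∀ e ∈ p.edges, ∃ z ∈ e, z ∉ q.support) →
          (T.deleteEdges {f}).Reachable w z := by
        intro w z p hp'
        refine ⟨p.toDeleteEdges {f} fun e he hef => ?_⟩
        obtain ⟨z, hz, hz'⟩ := hp' e he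
        rw [Set.mem_singleton_iff.1 hef] at hz
        exact hz' (hfsup z hz)
      have hxy : (T.deleteEdges {f}).Reachable x y :=
        ⟨p.mapLe (deleteEdges_anti (Set.singleton_subset_iff.2 hfcut))⟩
      exact r1.trans ((att px hpx').symm.trans (hxy.trans ((att py hpy').trans r2.symm)))
  obtain ⟨i, hi, px⟩ := hatt x
  obtain ⟨j, hj, py⟩ := hatt y
  rcases le_total i j with h | h
  · exact main p hp i j h hj px py
  · rw [← p.length_reverse]
    exact main p.reverse hp.reverse j i h hi py px

/-- A path is shorter than twice the longest path avoiding a given edge, plus one. -/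
lemma length_le_of_deleteEdges_singleton {e : Sym2 U} {D : ℕ}
    (hD : ∀ (x y : U) (p : (H.deleteEdges {e}).Walk x y), p.IsPath → p.length ≤ D) {x y : U}
    {p : H.Walk x y} (hp : p.IsPath) : p.length ≤ 2 * D + 1 := by
  have avoid : ∀ {x y : U} (p : H.Walk x y), p.IsPath → e ∉ p.edges → p.length ≤ D := by
    intro x y p hp he
    obtain ⟨p', hlen, -, -, hp'⟩ := exists_walk_deleteEdges p (F := {e}) fun e' he' h => he
      (by rwa [← Set.mem_singleton_iff.1 h])
    exact hlen ▸ hD x y p' (hp' hp)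
  -- A path uses the edge at most once, so it splits there into two avoiding paths.
  by_cases he : e ∈ p.edges
  · obtain ⟨a, b, p₁, h, p₂, hpe, rfl⟩ : ∃ (a b : U) (p₁ : H.Walk x a) (h : H.Adj a b)
        (p₂ : H.Walk b y), p = p₁.append (Walk.cons h p₂) ∧ e = s(a, b) := by
      clear hp
      induction p with
      | nil => simp at he
      | cons h p ih =>
        rw [Walk.edges_cons, List.mem_cons] at he
        rcases he with rfl | he
        · exact ⟨_, _, Walk.nil, h, p, rfl, rfl⟩
        · obtain ⟨a, b, p₁, h', p₂, rfl, h''⟩ := ih he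
          exact ⟨a, b, Walk.cons h p₁, h', p₂, rfl, h''⟩
    have hnodup := hp.isTrail.edges_nodup
    rw [hpe, Walk.edges_append, Walk.edges_cons, List.nodup_append, List.nodup_cons] at hnodup
    rw [hpe] at hp
    have h1 := avoid p₁ hp.of_append_left fun h' =>
      hnodup.2.2 _ h' _ List.mem_cons_self rfl
    have h2 := avoid p₂ ((Walk.cons_isPath_iff _ _).1 hp.of_append_right).1 hnodup.2.1.1
    rw [hpe, Walk.length_append, Walk.length_cons]
    lia
  · have := avoid p hp he
    lia

/-- An edge on a cycle is not a bridge, so connectivity survives; one extra edge at most means that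
the edge count falls to that of a tree. -/
lemma isTree_deleteEdges_of_isCycle [Finite U] (hH : IsTreeWithAtMostOneExtraEdge H) {v u : U}
    {h : H.Adj v u} {q : H.Walk u v} (hc : (Walk.cons h q).IsCycle) :
    (H.deleteEdges {s(v, u)}).IsTree := by
  obtain ⟨T, hT, hTH, hcard⟩ := hH
  have hconn : H.Connected := hT.connected.mono hTH
  have hbr : ¬ H.IsBridge s(v, u) := fun hb =>
    hb.notMem_edges_of_isCycle hc (by simp)
  have hconn' : (H.deleteEdges {s(v, u)}).Connected := hconn.connected_delete_edge_of_not_isBridge hbr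
  refine isTree_iff_connected_and_card.2 ⟨hconn', le_antisymm ?_ hconn'.card_vert_le_card_edgeSet_add_one⟩
  rw [← (isTree_iff_connected_and_card.1 hT).2]
  have hdiff : (H.edgeSet \ T.edgeSet).ncard ≤ 1 := by
    have := Set.encard_le_coe_iff.1 hcard
    obtain ⟨hfin, n, hn, hn'⟩ := this
    rw [Set.ncard, hn]
    simpa using hn'
  have h1 : H.edgeSet.ncard ≤ T.edgeSet.ncard + 1 := by
    have := Set.ncard_sdiff_add_ncard_of_subset (edgeSet_mono hTH) (Set.toFinite _)
    lia
  have h2 : (H.deleteEdges {s(v, u)}).edgeSet.ncard + 1 = H.edgeSet.ncard := by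
    rw [edgeSet_deleteEdges]
    exact Set.ncard_sdiff_singleton_add_one h (Set.toFinite _)
  simp only [Set.ncard, Set.encard] at h1 h2
  change Nat.card (H.deleteEdges {s(v, u)}).edgeSet + 1 = Nat.card H.edgeSet at h2
  change Nat.card H.edgeSet ≤ Nat.card T.edgeSet + 1 at h1
  lia

/-- Paths in a unicyclic graph, and how to cut them. -/
lemma unicyclic_paths [Finite U] (hH : IsTreeWithAtMostOneExtraEdge H) {v u : U}
    {h : H.Adj v u} {q : H.Walk u v} (hc : (Walk.cons h q).IsCycle) {D m : ℕ} (hm : 1 ≤ m)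
    (hD : ∀ w, ∃ x ∈ q.support, ∃ p : H.Walk w x, p.length ≤ D) :
    (∀ (x y : U) (p : H.Walk x y), p.IsPath → p.length ≤ 2 * (2 * D + q.length) + 1) ∧
      ∃ F : Finset (Sym2 U), F.card ≤ q.length / m + 2 ∧
        ∀ (x y : U) (p : (H.deleteEdges (F : Set (Sym2 U))).Walk x y), p.IsPath →
          p.length ≤ 2 * D + m := by
  classical
  set e := s(v, u) with he
  set T := H.deleteEdges {e} with hT
  have hTac : T.IsAcyclic := (isTree_deleteEdges_of_isCycle hH hc).isAcyclic
  obtain ⟨hqpath, hqe⟩ := (Walk.cons_isCycle_iff q h).1 hc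
  obtain ⟨q', hq'len, hq'sup, -, hq'path⟩ : ∃ q' : T.Walk u v, _ :=
    exists_walk_deleteEdges q (F := {e}) fun e' he' h' => hqe
      (by rwa [← he, ← Set.mem_singleton_iff.1 h'])
  replace hq'path := hq'path hqpath
  -- The spine is the cycle without `e`. Walks stopped on reaching it avoid `e`, both of whose ends
  -- lie on the spine, and so survive in `T`.
  have hatt : ∀ w, ∃ i ≤ q'.length, ∃ p : T.Walk w (q'.getVert i), p.length ≤ D ∧
      ∀ e ∈ p.edges, ∃ z ∈ e, z ∉ q'.support := by
    intro w
    obtain ⟨x, hx, p, hp⟩ := hD w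
    obtain ⟨y, hy, p', hp', hp''⟩ := exists_walk_avoiding (Q := {z | z ∈ q.support}) p hx
    have hy' : y ∈ q'.support := by rw [hq'sup]; exact hy
    obtain ⟨i, rfl, hi⟩ := Walk.mem_support_iff_exists_getVert.1 hy'
    obtain ⟨p'', hlen, -, hedges, -⟩ := exists_walk_deleteEdges p' (F := {e}) fun e' he' h' => by
      obtain ⟨z, hz, hz'⟩ := hp'' e' he'
      rw [Set.mem_singleton_iff.1 h', he] at hz
      rcases Sym2.mem_iff.1 hz with rfl | rfl
      · exact hz' q.end_mem_support
      · exact hz' q.start_mem_support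
    refine ⟨i, hi, p'', hlen ▸ hp'.trans hp, ?_⟩
    rw [hedges, hq'sup]
    exact hp''
  constructor
  · intro x y p hp
    refine length_le_of_deleteEdges_singleton (e := e) ?_ hp
    intro x y p hp
    obtain ⟨i, hi, px, hpx, -⟩ := hatt x
    obtain ⟨j, hj, py, hpy, -⟩ := hatt y
    obtain ⟨w, hw⟩ : ∃ w : T.Walk (q'.getVert i) (q'.getVert j), w.length ≤ q'.length := by
      rcases le_total i j with hij | hij
      · obtain ⟨w, hw⟩ := exists_walk_getVert q' hij hj
        exact ⟨w, by lia⟩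
      · obtain ⟨w, hw⟩ := exists_walk_getVert q' hij hi
        exact ⟨w.reverse, by rw [Walk.length_reverse]; lia⟩
    have := length_le_of_isAcyclic hTac hp ((px.append w).append py.reverse)
    simp only [Walk.length_append, Walk.length_reverse] at this
    lia
  · refine ⟨insert e ((Finset.range (q'.length / m + 1)).image fun k =>
      s(q'.getVert (k * m), q'.getVert (k * m + 1))), ?_, ?_⟩
    · refine (Finset.card_insert_le _ _).trans ?_
      have := Finset.card_image_le (s := Finset.range (q'.length / m + 1))
        (f := fun k => s(q'.getVert (k * m), q'.getVert (k * m + 1)))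
      rw [Finset.card_range, hq'len] at this
      rw [hq'len]
      lia
    · have hF : H.deleteEdges ((insert e ((Finset.range (q'.length / m + 1)).image fun k =>
          s(q'.getVert (k * m), q'.getVert (k * m + 1))) : Finset (Sym2 U)) : Set (Sym2 U)) =
          T.deleteEdges (cutEdges q' m) := by
        refine Eq.trans ?_ (deleteEdges_deleteEdges ..).symm
        congr 1
        ext e'
        simp [cutEdges]
      rw [hF]
      intro x y p hp
      exact length_le_of_cut hTac hq'path hm hatt hp

/-- Paths in a tree of small height. -/
lemma tree_paths (hac : H.IsAcyclic) (hconn : H.Connected) {r : U} {D : ℕ}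
    (hD : ∀ w, H.dist r w ≤ D) (x y : U) (p : H.Walk x y) (hp : p.IsPath) : p.length ≤ 2 * D := by
  obtain ⟨px, hpx⟩ := hconn.exists_walk_length_eq_dist r x
  obtain ⟨py, hpy⟩ := hconn.exists_walk_length_eq_dist r y
  have := length_le_of_isAcyclic hac hp (px.reverse.append py)
  rw [Walk.length_append, Walk.length_reverse] at this
  have := hD x
  have := hD y
  lia

/-- The shape of a shallow block: all its paths are short, cutting a bounded number of edges makes
them very short, and all its vertices are near a small set. -/
lemma shallow_block_structure [Fintype U] (hH : IsTreeWithAtMostOneExtraEdge H) {L x s : ℝ}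
    (hx : 20 ≤ x) (hs : 16 * x ^ 4 ≤ s) (hL : 8 * x ^ 9 ≤ L)
    (hcyc : ∀ (v : U) (c : H.Walk v v), c.IsCycle → (c.length : ℝ) ≤ 4 * (L / x ^ 4))
    (htree : H.IsAcyclic → ∃ r : U, ∀ w : U, (H.dist r w : ℝ) ≤ 4 * (L / s))
    (huni : ∀ (v : U) (c : H.Walk v v), c.IsCycle → ∀ w : U, ∃ y ∈ c.support,
      (H.dist y w : ℝ) ≤ x ^ 5 + 2 * (L / s)) :
    (∀ (a b : U) (p : H.Walk a b), p.IsPath → (p.length : ℝ) + 1 ≤ L) ∧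
    (∃ F : Finset (Sym2 U), F.card ≤ 18 ∧
      ∀ (a b : U) (p : (H.deleteEdges (F : Set (Sym2 U))).Walk a b), p.IsPath →
        (p.length : ℝ) ≤ L / x ^ 4) ∧
    ∃ R : Finset U, (R.card : ℝ) ≤ 4 * L + 1 ∧
      ∀ w, ∃ r ∈ R, ∃ p : H.Walk r w, (p.length : ℝ) ≤ L / x ^ 4 := by
  classical
  have hconn : H.Connected := by
    obtain ⟨T, hT, hTH, -⟩ := hH
    exact hT.connected.mono hTH
  have hx4 : 160000 ≤ x ^ 4 := by
    calc (160000 : ℝ) = 20 ^ 4 := by norm_num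
      _ ≤ x ^ 4 := pow_le_pow_left₀ (by norm_num) hx 4
  have hx40 : 0 < x ^ 4 := by linarith
  have hx5 : 0 < x ^ 5 := by positivity
  have hx9 : x ^ 9 = x ^ 4 * x ^ 5 := by ring
  have hx5' : 1 ≤ x ^ 5 := one_le_pow₀ (by linarith)
  have hx45 : x ^ 4 ≤ x ^ 9 := by rw [hx9]; exact le_mul_of_one_le_right hx40.le hx5'
  have hx59 : x ^ 5 * 160000 ≤ x ^ 9 := by
    rw [hx9, mul_comm]; exact mul_le_mul_of_nonneg_right hx4 hx5.le
  have hs0 : 0 < s := by linarith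
  have hL0 : 0 < L := by linarith
  set ℓ := L / x ^ 4 with hℓ
  have hℓ0 : 0 < ℓ := div_pos hL0 hx40
  have hLs : L / s ≤ ℓ / 16 := by
    rw [hℓ, div_div, div_le_div_iff_of_pos_left hL0 hs0 (by positivity)]
    linarith
  have hℓL : ℓ * 160000 ≤ L := by
    rw [hℓ, div_mul_eq_mul_div, div_le_iff₀ hx40]
    exact mul_le_mul_of_nonneg_left hx4 hL0.le
  have hℓ5 : 8 * x ^ 5 ≤ ℓ := by
    rw [hℓ, le_div_iff₀ hx40]; linarith
  have hx52 : (20 : ℝ) ^ 5 ≤ x ^ 5 := pow_le_pow_left₀ (by norm_num) hx 5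
  norm_num at hx52
  by_cases hac : H.IsAcyclic
  · obtain ⟨r, hr⟩ := htree hac
    have hr' : ∀ w, H.dist r w ≤ ⌊4 * (L / s)⌋₊ := fun w => Nat.le_floor (hr w)
    -- Here x = log d, s = √d, L = log n. A tree has paths of length at most 8L/s ≤ ℓ/2, so no cut
    -- is needed.
    have hpath : ∀ (a b : U) (p : H.Walk a b), p.IsPath → (p.length : ℝ) ≤ ℓ / 2 := by
      intro a b p hp
      have h1 := tree_paths hac hconn hr' a b p hp
      have h2 : (p.length : ℝ) ≤ 2 * ⌊4 * (L / s)⌋₊ := by exact_mod_cast h1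
      have h3 := Nat.floor_le (show 0 ≤ 4 * (L / s) by positivity)
      linarith
    refine ⟨fun a b p hp => ?_, ⟨∅, by simp, ?_⟩, {r}, ?_, ?_⟩
    · have := hpath a b p hp
      linarith
    · have h0 : H.deleteEdges ((∅ : Finset (Sym2 U)) : Set (Sym2 U)) = H := by simp
      rw [h0]
      intro a b p hp
      have := hpath a b p hp
      linarith
    · rw [Finset.card_singleton]; push_cast; linarith
    · intro w
      obtain ⟨p, hp⟩ := hconn.exists_walk_length_eq_dist r w
      refine ⟨r, Finset.mem_singleton_self r, p, ?_⟩
      rw [hp]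
      have := hr w
      linarith
  · obtain ⟨v, c, hc⟩ : ∃ (v : U) (c : H.Walk v v), c.IsCycle := by
      unfold IsAcyclic at hac
      push Not at hac
      exact hac
    cases c with
    | nil => exact absurd hc (by simp)
    | @cons _ u _ h q =>
      set D := ⌊x ^ 5 + 2 * (L / s)⌋₊ with hDdef
      have hDle : (D : ℝ) ≤ x ^ 5 + 2 * (L / s) := Nat.floor_le (by positivity)
      -- With this spacing, surviving paths have length at most 2D + m ≤ 2x⁵ + 4L/s + ℓ/2 ≤ ℓ/4 +
      -- ℓ/4 + ℓ/2. The cycle has length at most 4ℓ ≤ 16m, so 16 + 2 = 18 cuts are enough.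
      set m := ⌊ℓ / 2⌋₊ with hmdef
      have hm1 : (m : ℝ) ≤ ℓ / 2 := Nat.floor_le (by positivity)
      have hm2 : ℓ / 4 ≤ m := by
        have := Nat.lt_floor_add_one (ℓ / 2)
        linarith
      have hm : 1 ≤ m := by
        have : (0 : ℝ) < m := by linarith
        exact_mod_cast this
      have hqlen : (q.length : ℝ) + 1 ≤ 4 * ℓ := by
        have := hcyc v _ hc
        rw [Walk.length_cons] at this
        exact_mod_cast this
      have hsup : ∀ y ∈ (Walk.cons h q).support, y ∈ q.support := by
        intro y hy
        rw [Walk.support_cons, List.mem_cons] at hy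
        rcases hy with rfl | hy
        · exact q.end_mem_support
        · exact hy
      have hnear : ∀ w, ∃ y ∈ q.support, H.dist y w ≤ D := by
        intro w
        obtain ⟨y, hy, hd⟩ := huni v _ hc w
        exact ⟨y, hsup y hy, Nat.le_floor hd⟩
      have hD : ∀ w, ∃ y ∈ q.support, ∃ p : H.Walk w y, p.length ≤ D := by
        intro w
        obtain ⟨y, hy, hd⟩ := hnear w
        obtain ⟨p, hp⟩ := hconn.exists_walk_length_eq_dist y w
        exact ⟨y, hy, p.reverse, by rw [Walk.length_reverse, hp]; exact hd⟩
      obtain ⟨h1, F, hF, h2⟩ := unicyclic_paths hH hc hm hD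
      refine ⟨fun a b p hp => ?_, ⟨F, ?_, fun a b p hp => ?_⟩, q.support.toFinset, ?_, ?_⟩
      · have : (p.length : ℝ) ≤ 2 * (2 * D + q.length) + 1 := by exact_mod_cast h1 a b p hp
        linarith
      · have : q.length / m ≤ 16 := by
          rw [Nat.div_le_iff_le_mul_add_pred (by lia)]
          have : (q.length : ℝ) ≤ 16 * m := by linarith
          have : q.length ≤ 16 * m := by exact_mod_cast this
          lia
        lia
      · have : (p.length : ℝ) ≤ 2 * D + m := by exact_mod_cast h2 a b p hp
        linarith
      · have := q.support.toFinset_card_le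
        rw [Walk.length_support] at this
        have : (q.support.toFinset.card : ℝ) ≤ q.length + 1 := by exact_mod_cast this
        linarith
      · intro w
        obtain ⟨y, hy, hd⟩ := hnear w
        obtain ⟨p, hp⟩ := hconn.exists_walk_length_eq_dist y w
        refine ⟨y, List.mem_toFinset.2 hy, p, ?_⟩
        have : (p.length : ℝ) ≤ D := by rw [hp]; exact_mod_cast hd
        linarith

end GraphStructure

end SpinGlass

namespace SpinGlass

/-! ### Poincaré constant and size of a block. -/

section Blocks

variable {V : Type*} [Fintype V] [DecidableEq V] {G : SimpleGraph V} {J : Sym2 V → ℝ} {β : ℝ}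

lemma exists_walk_induce {H : SimpleGraph V} {s : Set V} {x y : V} (p : H.Walk x y)
    (hp : p.IsPath) (hs : ∀ z ∈ p.support, z ∈ s) :
    ∃ (a b : s) (p' : (H.induce s).Walk a b), p'.IsPath ∧ p'.length = p.length := by
  refine ⟨_, _, p.induce s hs, ?_, ?_⟩
  · refine SimpleGraph.Walk.IsPath.of_map (f := (SimpleGraph.Embedding.induce s).toHom) ?_
    rwa [SimpleGraph.Walk.map_induce]
  · have := congrArg SimpleGraph.Walk.length (p.map_induce (s := s) hs)
    rwa [SimpleGraph.Walk.length_map] at this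

lemma length_eq_zero_of_card_eq_one {H : SimpleGraph V} {B : Finset V} (hB : B.card = 1) {x y : V}
    (p : H.Walk x y) (hp : ∀ z ∈ p.support, z ∈ B) : p.length = 0 := by
  obtain ⟨b, rfl⟩ := Finset.card_eq_one.1 hB
  cases p with
  | nil => rfl
  | @cons _ u _ h q =>
    exfalso
    have h1 := hp x (by simp)
    have h2 := hp u (by simp)
    rw [Finset.mem_singleton] at h1 h2
    exact h.ne (h1.trans h2.symm)

/-- The metric structure of the blocks of a shallow block partition. -/
lemma block_structure {d ε : ℝ} (hx : 20 ≤ Real.log d) (hs : 16 * Real.log d ^ 4 ≤ √d)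
    (hL : 8 * Real.log d ^ 9 ≤ Real.log (Fintype.card V))
    {P : Finpartition (Finset.univ : Finset V)} (hP : IsBlockPartition G J β d ε P)
    (hsh : IsShallowPartition G d P) {B : Finset V} (hB : B ∈ P.parts) :
    (1 < B.card → ∀ (v x : V) (p : G.Walk v x), p.IsPath → (∀ y ∈ p.support, y ∈ B) →
      (p.length : ℝ) + 1 ≤ Real.log (Fintype.card V)) ∧
    (∃ F : Finset (Sym2 V), F.card ≤ 18 ∧
      ∀ (v x : V) (p : (G.deleteEdges (F : Set (Sym2 V))).Walk v x), p.IsPath →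
        (∀ y ∈ p.support, y ∈ B) →
          (p.length : ℝ) ≤ Real.log (Fintype.card V) / Real.log d ^ 4) ∧
    ∃ R : Finset V, (R.card : ℝ) ≤ 4 * Real.log (Fintype.card V) + 1 ∧
      ∀ w ∈ B, ∃ r ∈ R, ∃ p : G.Walk r w, p.IsPath ∧
        (p.length : ℝ) ≤ Real.log (Fintype.card V) / Real.log d ^ 4 := by
  have hLn : 0 ≤ Real.log (Fintype.card V) := Real.log_natCast_nonneg _
  rcases (Nat.one_le_iff_ne_zero.2 (Finset.card_ne_zero.2
    (P.nonempty_of_mem_parts hB))).eq_or_lt with hc | hc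
  · refine ⟨fun h => absurd h (by lia), ⟨∅, by simp, fun v x p _ hp => ?_⟩, B, ?_, fun w hw => ?_⟩
    · rw [length_eq_zero_of_card_eq_one hc.symm p hp, Nat.cast_zero]
      exact div_nonneg hLn (by positivity)
    · rw [← hc]; push_cast; linarith
    · exact ⟨w, hw, SimpleGraph.Walk.nil, by simp, by
        rw [SimpleGraph.Walk.length_nil, Nat.cast_zero]; exact div_nonneg hLn (by positivity)⟩
  · have hgood := hP B hB
    obtain ⟨h1, ⟨F, hF, h2⟩, R, hR, h3⟩ := shallow_block_structure hgood.shape hx hs hL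
      (hgood.cycle_short hc) (hsh B hB hc).1 (hsh B hB hc).2
    refine ⟨fun _ v x p hp hpB => ?_, ⟨F.image (Sym2.map Subtype.val),
      Finset.card_image_le.trans hF, fun v x p hp hpB => ?_⟩, R.image Subtype.val, ?_, ?_⟩
    · obtain ⟨a, b, p', hp', hlen⟩ := exists_walk_induce (s := (B : Set V)) p hp hpB
      rw [← hlen]
      exact h1 a b p' hp'
    · obtain ⟨a, b, p', hp', hlen⟩ := exists_walk_induce (s := (B : Set V)) p hp hpB
      have hle : (G.deleteEdges ((F.image (Sym2.map Subtype.val) : Finset (Sym2 V)) :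
          Set (Sym2 V))).induce (B : Set V) ≤
          (G.induce (B : Set V)).deleteEdges (F : Set (Sym2 (B : Set V))) := by
        intro a b hab
        rw [SimpleGraph.induce_adj, SimpleGraph.deleteEdges_adj] at hab
        rw [SimpleGraph.deleteEdges_adj, SimpleGraph.induce_adj]
        refine ⟨hab.1, fun h => hab.2 ?_⟩
        exact Finset.mem_coe.2 (Finset.mem_image.2 ⟨s(a, b), h, rfl⟩)
      have := h2 a b (p'.mapLe hle) (hp'.mapLe hle)
      rwa [SimpleGraph.Walk.mapLe, SimpleGraph.Walk.length_map, hlen] at this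
    · refine le_trans ?_ hR
      exact_mod_cast Finset.card_image_le
    · intro w hw
      obtain ⟨r, hr, p, hp⟩ := h3 ⟨w, hw⟩
      refine ⟨r, Finset.mem_image_of_mem _ hr,
        (p.map (SimpleGraph.Embedding.induce (B : Set V)).toHom).bypass,
        SimpleGraph.Walk.bypass_isPath _, le_trans ?_ hp⟩
      exact Nat.cast_le.2 ((SimpleGraph.Walk.length_bypass_le_length _).trans
        (SimpleGraph.Walk.length_map ..).le)

open Classical in
lemma log_degree_sum_nonneg {u v : V} (p : G.Walk u v) :
    0 ≤ ∑ x : V with x ∈ p.support, Real.log (G.degree x) :=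
  Finset.sum_nonneg fun _ _ => Real.log_natCast_nonneg _

lemma touchingWeight_le_comparisonWeight (hβ : 0 ≤ β) {G' : SimpleGraph V} (h : G' ≤ G) {u v : V}
    (p : G'.Walk u v) : β * touchingWeight J G' p ≤ comparisonWeight G J β (p.mapLe h) := by
  classical
  have h0 := log_degree_sum_nonneg (p.mapLe h)
  have h1 : touchingWeight J G' p ≤
      ∑ e ∈ G.edgeFinset with (∃ x ∈ (p.mapLe h).support, x ∈ e), |J e| := by
    unfold touchingWeight
    refine Finset.sum_le_sum_of_subset_of_nonneg ?_ fun _ _ _ => abs_nonneg _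
    intro e he
    rw [Finset.mem_filter, SimpleGraph.mem_edgeFinset] at he ⊢
    refine ⟨SimpleGraph.edgeSet_mono h he.1, ?_⟩
    simpa using he.2
  have h2 := mul_le_mul_of_nonneg_left h1 hβ
  have h3 : comparisonWeight G J β (p.mapLe h) =
      β * (∑ e ∈ G.edgeFinset with (∃ x ∈ (p.mapLe h).support, x ∈ e), |J e|) +
        ∑ x : V with x ∈ (p.mapLe h).support, Real.log (G.degree x) := by
    unfold comparisonWeight
    congr!
  rw [h3]
  linarith

/-- The truncation at 1 is free, since `Real.log 0 = 0 = Real.log 1`. -/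
lemma prod_degree_le_exp_comparisonWeight (hβ : 0 ≤ β) [DecidableRel G.Adj] {u v : V}
    (p : G.Walk u v) (hp : p.IsPath) :
    (p.support.map fun y => max 1 (G.degree y : ℝ)).prod ≤
      Real.exp (comparisonWeight G J β p) := by
  classical
  have hpos : ∀ y, 0 < max 1 (G.degree y : ℝ) := fun y => lt_max_of_lt_left one_pos
  have hlog : ∀ y, Real.log (max 1 (G.degree y : ℝ)) = Real.log (G.degree y) := by
    intro y
    rcases Nat.eq_zero_or_pos (G.degree y) with h | h
    · simp [h]
    · rw [max_eq_right (by exact_mod_cast h)]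
  have hsupp : ∑ x : V with x ∈ p.support, Real.log (G.degree x) =
      (p.support.map fun y => Real.log (max 1 (G.degree y : ℝ))).sum := by
    simp only [hlog]
    rw [← List.sum_toFinset _ hp.support_nodup]
    exact Finset.sum_congr (by ext; simp) fun _ _ => rfl
  have hprod : (p.support.map fun y => max 1 (G.degree y : ℝ)).prod =
      Real.exp (p.support.map fun y => Real.log (max 1 (G.degree y : ℝ))).sum := by
    induction p.support with
    | nil => simp
    | cons a l ih =>
      rw [List.map_cons, List.prod_cons, List.map_cons, List.sum_cons, Real.exp_add,
        Real.exp_log (hpos a), ih]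
  rw [hprod, ← hsupp]
  refine Real.exp_le_exp.2 ?_
  unfold comparisonWeight
  refine le_trans (le_of_eq ?_) (le_add_of_nonneg_left (mul_nonneg hβ
    (Finset.sum_nonneg fun _ _ => abs_nonneg _)))
  congr!

lemma deletedWeight_le {b : ℝ} (hb : ∀ e ∈ G.edgeSet, |J e| ≤ b) (hb0 : 0 ≤ b)
    (F' : Set (Sym2 V)) (F : Finset (Sym2 V)) (hF : ∀ e ∈ F', e ∈ F) :
    deletedWeight J G F' ≤ F.card * b := by
  classical
  unfold deletedWeight
  refine (Finset.sum_le_card_nsmul _ _ b fun e he => hb e ?_).trans ?_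
  · simpa using (Finset.mem_filter.1 he).1
  · rw [nsmul_eq_mul]
    refine mul_le_mul_of_nonneg_right ?_ hb0
    refine Nat.cast_le.2 (Finset.card_le_card (t := F) fun e he => ?_)
    exact hF e (Finset.mem_filter.1 he).2

/-- The path bound limits the degree products, hence the number of ends of short paths from each
point of R. These paths may leave B. -/
lemma card_block_le {ℓ b w : ℝ} (hℓ : 0 ≤ ℓ) (hβ : 0 ≤ β) (hw : 0 ≤ w)
    (hpath : ∀ (u v : V) (p : G.Walk u v), p.IsPath → (p.length : ℝ) ≤ ℓ →
      comparisonWeight G J β p ≤ w)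
    {B R : Finset V} (hR : (R.card : ℝ) ≤ b)
    (hBR : ∀ w ∈ B, ∃ r ∈ R, ∃ p : G.Walk r w, p.IsPath ∧ (p.length : ℝ) ≤ ℓ) :
    (B.card : ℝ) ≤ b * ((ℓ + 1) * Real.exp w) := by
  classical
  set N : V → Finset V := fun r => Finset.univ.filter fun x => ∃ p : G.Walk r x, p.IsPath ∧
    p.length ≤ ⌊ℓ⌋₊ ∧ ∀ y ∈ p.support, y ∈ Finset.univ
  have hsub : B ⊆ R.biUnion N := by
    intro x hx
    obtain ⟨r, hr, p, hp, hlen⟩ := hBR x hx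
    exact Finset.mem_biUnion.2 ⟨r, hr, Finset.mem_filter.2
      ⟨Finset.mem_univ x, p, hp, Nat.le_floor hlen, fun y _ => Finset.mem_univ y⟩⟩
  have hN : ∀ r, ((N r).card : ℝ) ≤ (ℓ + 1) * Real.exp w := by
    intro r
    refine (card_path_ends_le G ⌊ℓ⌋₊ Finset.univ r (Real.exp w) (Finset.mem_univ r)
      (Real.one_le_exp hw) ?_).trans ?_
    · intro x p hp hlen _
      have hlen' : (p.length : ℝ) ≤ ℓ := (Nat.cast_le.2 hlen).trans (Nat.floor_le hℓ)
      have := (prod_degree_le_exp_comparisonWeight (J := J) hβ p hp).trans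
        (Real.exp_le_exp.2 (hpath r x p hp hlen'))
      convert this
    · exact mul_le_mul_of_nonneg_right (by linarith [Nat.floor_le hℓ]) (Real.exp_pos _).le
  have h1 : (B.card : ℝ) ≤ ∑ r ∈ R, ((N r).card : ℝ) := by
    exact_mod_cast (Finset.card_le_card hsub).trans Finset.card_biUnion_le
  refine h1.trans ((Finset.sum_le_card_nsmul _ _ _ fun r _ => hN r).trans ?_)
  rw [nsmul_eq_mul]
  exact mul_le_mul_of_nonneg_right hR (by positivity)

/-- Every vertex is admitted as a root: without the edges of F, all paths in B are short enough for
the path bound. -/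
lemma isPoincare_block (hβ : 0 ≤ β) {ℓ w b : ℝ} (hw : 0 ≤ w) (hb0 : 0 ≤ b)
    (hpath : ∀ (u v : V) (p : G.Walk u v), p.IsPath → (p.length : ℝ) ≤ ℓ →
      comparisonWeight G J β p ≤ w)
    (hb : ∀ e ∈ G.edgeSet, |J e| ≤ b) {B : Finset V} {F : Finset (Sym2 V)}
    (hF : ∀ (v x : V) (p : (G.deleteEdges (F : Set (Sym2 V))).Walk v x), p.IsPath →
      (∀ y ∈ p.support, y ∈ B) → (p.length : ℝ) ≤ ℓ) :
    IsPoincare (gibbsWeight G J β) B (Real.exp (β * (F.card * b)) * Real.exp w) := by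
  have h1 := isPoincare_of_paths J hβ B (G.deleteEdges (F : Set (Sym2 V))) Set.univ w hw
    (fun x hx => ⟨x, Set.mem_univ x, SimpleGraph.Walk.nil, by simpa using hx⟩)
    (fun r _ x p hp hpB => by
      have hle := G.deleteEdges_le (F : Set (Sym2 V))
      refine (touchingWeight_le_comparisonWeight hβ hle p).trans
        (hpath r x _ (hp.mapLe hle) ?_)
      have := hF r x p hp hpB
      rwa [SimpleGraph.Walk.mapLe, SimpleGraph.Walk.length_map])
  refine (h1.of_deleteEdges J hβ G _ (Real.exp_pos _).le).mono (gibbsWeight_pos G J β) ?_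
  refine mul_le_mul_of_nonneg_right (Real.exp_le_exp.2 ?_) (Real.exp_pos _).le
  exact mul_le_mul_of_nonneg_left (deletedWeight_le hb hb0 (F : Set (Sym2 V)) F (fun _ he => he)) hβ

end Blocks

/-! ### Numerical estimates. -/

lemma sixteen_mul_log_pow_le_sqrt {d : ℝ} (hd : Real.exp 61440 ≤ d) :
    16 * Real.log d ^ 4 ≤ √d := by
  have hd0 : 0 < d := (Real.exp_pos _).trans_le hd
  have hx : 61440 ≤ Real.log d := (Real.le_log_iff_exp_le hd0).2 hd
  have h1 : √d = Real.exp (Real.log d / 2) := by rw [Real.exp_half, Real.exp_log hd0]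
  rw [h1]
  -- With x = log d, √d ≥ (x/2)⁵/5! = x⁵/3840, and 61440 = 16·3840.
  have h2 := Real.pow_div_factorial_le_exp (Real.log d / 2) (by linarith) 5
  refine le_trans ?_ h2
  have h3 : (Nat.factorial 5 : ℝ) = 120 := by norm_num [Nat.factorial]
  rw [h3, le_div_iff₀ (by norm_num), div_pow]
  have h4 : 0 ≤ Real.log d ^ 4 := by positivity
  nlinarith [mul_le_mul_of_nonneg_right hx h4]

/-- 4L+1 ≤ exp(4√L) and L+1 ≤ exp(2√L), so 546 = 4+2+540, and √L ≥ 546x² turns 546√L into at most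
L/x². -/
lemma polynomial_mul_exp_sqrt_le {L x : ℝ} (hx : 0 < x) (hL : (546 * x ^ 2) ^ 2 ≤ L) :
    (4 * L + 1) * (L + 1) * Real.exp (540 * √L) ≤ Real.exp (L / x ^ 2) := by
  have hL0 : 0 ≤ L := (sq_nonneg _).trans hL
  have hs := Real.sqrt_nonneg L
  have hsq := Real.sq_sqrt hL0
  have key : ∀ c : ℝ, 0 ≤ c → c ^ 2 * L + 1 ≤ Real.exp (2 * c * √L) := by
    intro c hc
    have h1 : 2 * c * √L = c * √L + c * √L := by ring
    rw [h1, Real.exp_add]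
    have h2 := Real.add_one_le_exp (c * √L)
    have h3 : 0 ≤ c * √L := mul_nonneg hc hs
    nlinarith [mul_le_mul h2 h2 (by linarith) (Real.exp_pos _).le]
  have h1 := key 2 (by norm_num)
  have h2 := key 1 (by norm_num)
  norm_num at h1 h2
  have h3 : 546 * x ^ 2 ≤ √L := Real.le_sqrt_of_sq_le hL
  calc (4 * L + 1) * (L + 1) * Real.exp (540 * √L)
      ≤ Real.exp (4 * √L) * Real.exp (2 * √L) * Real.exp (540 * √L) := by gcongr
    _ = Real.exp (546 * √L) := by rw [← Real.exp_add, ← Real.exp_add]; ring_nf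
    _ ≤ Real.exp (L / x ^ 2) := by
        refine Real.exp_le_exp.2 ?_
        rw [le_div_iff₀ (by positivity)]
        nlinarith [mul_le_mul_of_nonneg_left h3 hs]

/-! ### Assembly of the two bounds. -/

section Main

variable {V : Type*} [Fintype V] [DecidableEq V] {G : SimpleGraph V} {J : Sym2 V → ℝ} {β d ε : ℝ}
  {P : Finpartition (Finset.univ : Finset V)}

lemma InGoodClass.lt_one (hd : 0 < d) (h : InGoodClass G J β d ε) : ε < 1 := by
  have h1 := h.beta_pos.trans_le h.beta_le
  have h2 : 0 ≤ criticalBeta d := by unfold criticalBeta; positivity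
  by_contra! h3
  nlinarith

lemma InGoodClass.beta_le_three (hd : 1 ≤ d) (hε : 0 < ε) (h : InGoodClass G J β d ε) :
    β ≤ 3 := by
  have h1 : √(2 * Real.pi) ≤ 3 := by
    rw [Real.sqrt_le_left (by norm_num)]
    nlinarith [Real.pi_lt_d2]
  have h2 : criticalBeta d ≤ 3 := (div_le_self (Real.sqrt_nonneg _) hd).trans h1
  have h3 : 0 ≤ criticalBeta d := by unfold criticalBeta; positivity
  have := h.beta_le
  nlinarith

/-- The lower bound on |J_e| serves only to make influences nonzero, so that the path recursion may
divide by A(v). -/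
lemma InGoodClass.edgeInfluence_pos (h : InGoodClass G J β d ε) {u w : V} (huw : G.Adj u w) :
    0 < edgeInfluence J β s(u, w) := by
  have hn : (0 : ℝ) < Fintype.card V := by exact_mod_cast Fintype.card_pos_iff.2 ⟨u⟩
  have hJ : 0 < |J s(u, w)| := (Real.rpow_pos_of_pos hn _).trans_le (h.coupling_lower _ huw)
  refine div_pos (abs_pos.2 ?_) (by positivity)
  rw [sub_ne_zero, ne_comm, Ne, Real.exp_eq_one_iff]
  exact mul_ne_zero h.beta_pos.ne' (abs_pos.1 hJ)

theorem relaxationTime_blockDynamics_le (hε : 0 < ε) (hd : 2 ≤ d) (h : InGoodClass G J β d ε)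
    (hP : IsBlockPartition G J β d ε P) (hx : 20 ≤ Real.log d)
    (hs : 16 * Real.log d ^ 4 ≤ √d) (hL : 8 * Real.log d ^ 9 ≤ Real.log (Fintype.card V))
    (hL1 : 1 ≤ Real.log (Fintype.card V)) (hsh : IsShallowPartition G d P) :
    relaxationTime (blockDynamics (gibbs G J β) P.parts) ≤
      ENNReal.ofReal (1 / (1 - contraction ε) *
        (Fintype.card V * Real.log (Fintype.card V))) := by
  have hε1 := h.lt_one (by linarith)
  have hκ := contraction_lt_one hε hε1
  have hV : Nonempty V := by
    by_contra hne
    rw [not_nonempty_iff] at hne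
    simp only [Fintype.card_eq_zero, Nat.cast_zero, Real.log_zero] at hL1
    linarith
  have hN : 0 < P.parts.card :=
    Finset.card_pos.2 ⟨_, P.part_mem.2 (Finset.mem_univ hV.some)⟩
  have hN' : (0 : ℝ) < P.parts.card := by exact_mod_cast hN
  have hκ' : 0 < 1 - contraction ε := by linarith
  have hgap := secondEigenvalue_blockDynamics_le G J β P (fun u w => h.edgeInfluence_pos)
    (contraction_nonneg hε1) hN fun B hB v hv hw x p hp hpB =>
      prod_aggregateInfluence_le hd hε hε1 (hP B hB) (block_structure hx hs hL hP hsh hB).1 hv hw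
        p hp hpB
  have h1 := relaxationTime_le (P := blockDynamics (gibbs G J β) P.parts)
    (T := P.parts.card / (1 - contraction ε)) (div_pos hN' hκ') (by rwa [one_div_div])
  refine h1.trans (ENNReal.ofReal_le_ofReal ?_)
  rw [div_eq_mul_one_div, mul_comm]
  refine mul_le_mul_of_nonneg_left ?_ (by positivity)
  -- There are at most n blocks, so n/(1-κ) is already a bound; log n ≥ 1 brings it to the stated
  -- form.
  have h2 : (P.parts.card : ℝ) ≤ Fintype.card V := by
    exact_mod_cast P.card_parts_le_card.trans_eq Finset.card_univ
  nlinarith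

theorem relaxationTime_block_le (hε : 0 < ε) (hd : 1 ≤ d) (h : InGoodClass G J β d ε)
    (hP : IsBlockPartition G J β d ε P) (hx : 20 ≤ Real.log d)
    (hs : 16 * Real.log d ^ 4 ≤ √d) (hL : 8 * Real.log d ^ 9 ≤ Real.log (Fintype.card V))
    (hL2 : (546 * Real.log d ^ 2) ^ 2 ≤ Real.log (Fintype.card V))
    (hsh : IsShallowPartition G d P) {B : Finset V} (hB : B ∈ P.parts) (ξ : V → Spin) :
    relaxationTime (glauberDynamics (blockGibbs G J β B ξ)) ≤
      ENNReal.ofReal ((Fintype.card V : ℝ) ^ (3 / Real.log d ^ 2)) := by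
  obtain ⟨-, ⟨F, hF, hFpath⟩, R, hR, hBR⟩ := block_structure hx hs hL hP hsh hB
  have hBne := P.nonempty_of_mem_parts hB
  have hn : (0 : ℝ) < Fintype.card V := by
    exact_mod_cast Fintype.card_pos_iff.2 ⟨hBne.choose⟩
  set L := Real.log (Fintype.card V) with hLdef
  set x := Real.log d
  have hx0 : 0 < x := by linarith
  have hL0 : 0 ≤ L := (sq_nonneg _).trans hL2
  have hβ := h.beta_pos.le
  have hw : 0 ≤ L / x ^ 2 := by positivity
  have hℓ : L / x ^ 4 ≤ L := div_le_self hL0 (one_le_pow₀ (by linarith))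
  have hcard := card_block_le (b := 4 * L + 1) (by positivity : 0 ≤ L / x ^ 4) hβ hw
    h.path_bound hR hBR
  have hpoin := isPoincare_block hβ hw (by positivity) h.path_bound h.coupling_upper hFpath
  -- 540 = 3·18·10: β ≤ 3, at most 18 cut edges, couplings at most 10√L.
  have hcut : β * (F.card * (10 * √L)) ≤ 540 * √L := by
    have h1 : (F.card : ℝ) ≤ 18 := by exact_mod_cast hF
    have h2 := h.beta_le_three hd hε
    have h3 := Real.sqrt_nonneg L
    calc β * (F.card * (10 * √L)) ≤ 3 * (18 * (10 * √L)) := by gcongr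
      _ = 540 * √L := by ring
  have hpoin' := hpoin.mono (gibbsWeight_pos G J β)
    (mul_le_mul_of_nonneg_right (Real.exp_le_exp.2 hcut) (Real.exp_pos _).le)
  have hT : 1 ≤ Real.exp (540 * √L) * Real.exp (L / x ^ 2) :=
    one_le_mul_of_one_le_of_one_le (Real.one_le_exp (by positivity)) (Real.one_le_exp hw)
  refine (relaxationTime_glauberDynamics_blockGibbs_le B ξ G J β hBne hT hpoin').trans
    (ENNReal.ofReal_le_ofReal ?_)
  rw [Real.rpow_def_of_pos hn, ← hLdef]
  -- One factor each for the size of the block, for the path elimination, and for the cuts together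
  -- with the powers of log n.
  have hexp : Real.exp (L * (3 / x ^ 2)) =
      Real.exp (L / x ^ 2) * Real.exp (L / x ^ 2) * Real.exp (L / x ^ 2) := by
    rw [← Real.exp_add, ← Real.exp_add]; congr 1; ring
  rw [hexp]
  calc (B.card : ℝ) * (Real.exp (540 * √L) * Real.exp (L / x ^ 2))
      ≤ (4 * L + 1) * ((L + 1) * Real.exp (L / x ^ 2)) *
          (Real.exp (540 * √L) * Real.exp (L / x ^ 2)) := by
        refine mul_le_mul_of_nonneg_right (hcard.trans ?_) (by positivity)
        gcongr
    _ = (4 * L + 1) * (L + 1) * Real.exp (540 * √L) * Real.exp (L / x ^ 2) *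
          Real.exp (L / x ^ 2) := by ring
    _ ≤ _ := by
        have := polynomial_mul_exp_sqrt_le hx0 hL2
        gcongr

end Main

end SpinGlass

theorem mainTheorem5 :
    ∀ ε : ℝ, 0 < ε → ∃ d₀ : ℝ, 1 ≤ d₀ ∧ ∀ d : ℝ, d₀ ≤ d →
      ∃ C : ℝ, 0 < C ∧ ∃ n₀ : ℕ,
        ∀ (V : Type*) [Fintype V] [DecidableEq V] (G : SimpleGraph V) (J : Sym2 V → ℝ) (β : ℝ)
          (P : Finpartition (Finset.univ : Finset V)),
          n₀ ≤ Fintype.card V →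
          SpinGlass.InGoodClass G J β d ε →
          SpinGlass.IsBlockPartition G J β d ε P →
          SpinGlass.IsShallowPartition G d P →
            SpinGlass.relaxationTime
                (SpinGlass.blockDynamics (SpinGlass.gibbs G J β) P.parts) ≤
              ENNReal.ofReal (C * (Fintype.card V * Real.log (Fintype.card V))) ∧
            ∀ B ∈ P.parts, ∀ ξ : V → SpinGlass.Spin,
              SpinGlass.relaxationTime
                  (SpinGlass.glauberDynamics (SpinGlass.blockGibbs G J β B ξ)) ≤
                ENNReal.ofReal ((Fintype.card V : ℝ) ^ (3 / Real.log d ^ 2)) := by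
  intro ε hε
  refine ⟨Real.exp 61440, Real.one_le_exp (by norm_num), fun d hd => ?_⟩
  have hd0 : 0 < d := (Real.exp_pos _).trans_le hd
  have hd2 : 2 ≤ d := by linarith [Real.add_one_le_exp 61440]
  have hx : 20 ≤ Real.log d := by
    have := (Real.le_log_iff_exp_le hd0).2 hd
    linarith
  have hs := SpinGlass.sixteen_mul_log_pow_le_sqrt hd
  by_cases hε1 : ε < 1
  · have hκ := SpinGlass.contraction_lt_one hε hε1
    -- Summing the three thresholds for log n in the exponent meets them all.
    refine ⟨1 / (1 - SpinGlass.contraction ε), one_div_pos.2 (by linarith),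
      ⌈Real.exp (1 + 8 * Real.log d ^ 9 + (546 * Real.log d ^ 2) ^ 2)⌉₊, ?_⟩
    intro V _ _ G J β P hn hG hP hsh
    have hn' := (Nat.ceil_le.1 hn)
    have hn0 : (0 : ℝ) < Fintype.card V := (Real.exp_pos _).trans_le hn'
    have hL := (Real.le_log_iff_exp_le hn0).2 hn'
    have h1 : 0 ≤ 8 * Real.log d ^ 9 := by positivity
    have h2 : 0 ≤ (546 * Real.log d ^ 2) ^ 2 := by positivity
    exact ⟨SpinGlass.relaxationTime_blockDynamics_le hε hd2 hG hP hx hs (by linarith) (by linarith)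
      hsh, fun B hB ξ => SpinGlass.relaxationTime_block_le hε (by linarith) hG hP hx hs
        (by linarith) (by linarith) hsh hB ξ⟩
  -- For ε ≥ 1 the class is empty, as 0 < β ≤ (1-ε)β_c(d) is impossible.
  · refine ⟨1, one_pos, 0, ?_⟩
    intro V _ _ G J β P _ hG
    exact absurd (hG.lt_one hd0) hε1
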